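/- All graphs are finite and have no loops or parallel edges; $|G|$ denotes the number of vertices of $G$. Let $H'$ be a graph, and let $H$ be a graph obtained from $H'$ by subdividing every edge at least once, that is, by replacing each edge by a path of length at least two, where the internal vertices of these paths are new, distinct for different edges, and have degree two in $H$. Then $H$ is almost-bipartite: $H$ is triangle-free, and $V(H)$ can be partitioned into a (possibly empty) stable set and a (possibly empty) set inducing a subgraph of maximum degree at most one. Moreover, there exist an integer $s>0$ and a real number $\varepsilon>0$ such that the following holds for every $c$ with $0<c\le 1$ and every graph $G$, with $n=|G|$. Suppose that $G$ is $\varepsilon$-bounded (for every vertex $v$, the set consisting of $v$ and its neighbours has fewer than $\varepsilon n$ elements) and $H$-free (no induced subgraph of $G$ is isomorphic to $H$). Then $G$ has a $c$-sparse $(\varepsilon c^s n,\varepsilon n)$-pair: there are disjoint sets $A,B\subseteq V(G)$ with $|A|\ge \varepsilon c^s n$ and $|B|\ge \varepsilon n$ such that at most $c|A|\cdot|B|$ edges of $G$ have one end in $A$ and the other in $B$. -/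

import Mathlib

open scoped SimpleGraph

/-- The relation "`y` comes right after `x` on the path that replaces some edge `e`, travelled from
`(o e).1` to `(o e).2`". The edge `e` receives `ℓ e` internal vertices `(e, 0), …, (e, ℓ e - 1)`;
if `ℓ e = 0`, the edge is kept as it is. -/
def SubdivStep {V : Type*} (G : SimpleGraph V) (o : G.edgeSet → V × V) (ℓ : G.edgeSet → ℕ) :
    V ⊕ (Σ e : G.edgeSet, Fin (ℓ e)) → V ⊕ (Σ e : G.edgeSet, Fin (ℓ e)) → Prop
  | .inl u, .inl v => ∃ e : G.edgeSet, ℓ e = 0 ∧ o e = (u, v)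
  | .inl u, .inr y => (o y.1).1 = u ∧ (y.2 : ℕ) = 0
  | .inr x, .inl v => (o x.1).2 = v ∧ (x.2 : ℕ) + 1 = ℓ x.1
  | .inr x, .inr y => x.1 = y.1 ∧ (x.2 : ℕ) + 1 = (y.2 : ℕ)

/-- The graph obtained from `G` by replacing every edge `e` by a path with `ℓ e` new internal
vertices, that is, by a path of length `ℓ e + 1`. Here `o e` lists the two ends of `e` in some
order; the choice of the order matters only up to isomorphism. -/
def subdivide {V : Type*} (G : SimpleGraph V) (o : G.edgeSet → V × V) (ℓ : G.edgeSet → ℕ) :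
    SimpleGraph (V ⊕ (Σ e : G.edgeSet, Fin (ℓ e))) :=
  SimpleGraph.fromRel (SubdivStep G o ℓ)

/-- `H` is a (≥ 1)-subdivision of `H'`: up to isomorphism, it arises from `H'` by replacing every
edge by a path with at least one internal vertex. -/
def IsGeOneSubdivision {W V : Type*} (H : SimpleGraph W) (H' : SimpleGraph V) : Prop :=
  ∃ (o : H'.edgeSet → V × V) (ℓ : H'.edgeSet → ℕ),
    (∀ e, s((o e).1, (o e).2) = (e : Sym2 V)) ∧ (∀ e, 1 ≤ ℓ e) ∧
      Nonempty (H ≃g subdivide H' o ℓ)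

/-- `H` is almost-bipartite: triangle-free, and its vertex set is the disjoint union of a stable set
and a set inducing a subgraph of maximum degree at most one. -/
def IsAlmostBipartite {W : Type*} (H : SimpleGraph W) : Prop :=
  H.CliqueFree 3 ∧
    ∃ A B : Set W, Disjoint A B ∧ A ∪ B = Set.univ ∧ H.IsIndepSet A ∧
      ∀ v : B, ((H.induce B).neighborSet v).encard ≤ 1

/-- A finite graph `G` is `ε`-bounded: every closed neighbourhood has fewer than `ε |G|`
vertices. -/
def IsBoundedGraph {U : Type*} (G : SimpleGraph U) (ε : ℝ) : Prop :=
  ∀ v : U, ((insert v (G.neighborSet v)).ncard : ℝ) < ε * Nat.card U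

/-- `(A, B)` is an `(x, y)`-pair: `A`, `B` are disjoint, `|A| ≥ x` and `|B| ≥ y`. -/
def IsXYPair {U : Type*} (x y : ℝ) (A B : Finset U) : Prop :=
  Disjoint A B ∧ x ≤ A.card ∧ y ≤ B.card

open Classical in
/-- `(A, B)` is `c`-sparse: `A`, `B` are disjoint and at most `c |A| |B|` edges of `G` join `A` to
`B`. (As `A` and `B` are disjoint, `G.interedges A B` has exactly one element per such edge.) -/
def IsSparsePair {U : Type*} (G : SimpleGraph U) (c : ℝ) (A B : Finset U) : Prop :=
  Disjoint A B ∧ ((G.interedges A B).card : ℝ) ≤ c * A.card * B.card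

/-!
Let `G` be an `ε`-bounded graph with `n` vertices and no `c`-sparse `(ε c ^ s n, ε n)`-pair. Such a
graph is *rich* (`isRich_of_forall_not_isSparsePair`): if a set `A` is
not too small, then all but `5 ε n` vertices have at least `c |A| / 2` neighbours in `A`, and if `A`
contains half of the vertices, then all but `ε c ^ s n` have. It has to be shown that a rich graph
contains `H` as an induced subgraph.

**Random embeddings.** Vertices are embedded in `G` one after the other at random, each next to its
parents. A set of embedded vertices is harmless if its joint distribution has bounded density with
respect to the uniform one: as `G` is `ε`-bounded, two vertices with bounded joint density are
distinct and nonadjacent with probability close to one. To keep densities bounded, a vertex is not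
chosen uniformly among the common neighbours of its parents, but by a fractional assignment in which
no target receives more than twice its fair share (`exists_fractional_assignment`). For a vertex with
any number of parents this bounds the joint density with every set of earlier vertices that has
bounded joint density with the parents (`IsPartialDensity.exists_succ_of_not_strong`). For a vertex
with a single parent, the second form of richness permits conditioning on all other vertices, although
the conditional density is only bounded by a power of `1 / c`: the new vertex is then well
distributed relative to everything but its parent (`IsPartialDensity.exists_succ_of_strong`). An
`EmbeddingPattern` records parents, and as *links* the pairs whose joint density remains
uncontrolled; `EmbeddingPattern.exists_embedding` embeds it such that parents are adjacent to their
children, and unlinked vertices are distinct and nonadjacent.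

**The pattern.** By induction one finds a graph `Q` such that, whichever of its edges are red, there
is an induced copy of `H` all of whose edges are red, or a large clique without red edges
(`exists_inducedRamsey_clique`). The pattern has a main vertex for each vertex of `Q`, common
neighbours of main vertices adjacent in `Q`, and for each triple `u < v < w` of vertices of `Q` a
path with three vertices, adjacent to the main vertices of `u`, `v` and `w` in turn. The only links
besides those with parents are between adjacent vertices of `Q`, and between a vertex of such a path
and the main vertex its successor sees. Colour an edge of `Q` red if the two main vertices are
adjacent in `G`. A red induced copy of `H` is an induced copy of `H` in `G`. Otherwise there are many
pairwise nonadjacent main vertices, joined by induced paths of length two. For `u < v < w` among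
these, consider the middle vertex of the path of the triple. If it is nonadjacent to the main vertex
of `w`, then the last two vertices of the path form a path of length three from `v` to `w`;
otherwise, the first two form one from `u` to `w`. By Ramsey's theorem there are many main vertices
joined by paths of both lengths, that is, a large `hostGraph`
(`PatternVertex.exists_card_forall_exists_embedding_hostGraph`).

**Subdivisions.** Every number that is at least two is a sum of twos and at most one three, so all
subdivisions are induced subgraphs of host graphs (`exists_embedding_hostGraph`). As host graphs are
almost-bipartite, this also gives the first claim.
-/

/-! ### Fractional assignments -/

/-- Resampling one coordinate does not change an average over all functions. -/
theorem sum_sum_update {I U : Type*} [Fintype I] [DecidableEq I] [Fintype U] (i : I)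
    (g : (I → U) → ℝ) :
    ∑ z, ∑ a, g (Function.update z i a) = Fintype.card U * ∑ z, g z := by
  have hinv : Function.Involutive
      (fun p : (I → U) × U => (Function.update p.1 i p.2, p.1 i)) := by
    intro p
    ext <;> simp
  rw [← Fintype.sum_prod_type' (fun z a => g (Function.update z i a)),
    ← Equiv.sum_comp hinv.toPerm]
  simp [Function.Involutive.toPerm, Fintype.sum_prod_type, Finset.mul_sum]

/-- Points `x` of weight `w x` distribute mass over their target sets `A x`: every point gives at
most `L` to each target and at most `|U|` in total, no target receives more than twice its fair
share, and every point with many targets outside some set `F` of at most half of the vertices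
distributes all of its mass. The assignment is one of maximal total mass, and `F` consists of the
targets that are filled up. -/
theorem exists_fractional_assignment {X U : Type*} [Fintype X] [Fintype U] [DecidableEq U]
    (w : X → ℝ) (hw : ∀ x, 0 ≤ w x) (hW : 0 < ∑ x, w x) (A : X → Finset U) {L : ℝ} (hL : 0 ≤ L) :
    ∃ k : X → U → ℝ, (∀ x u, 0 ≤ k x u) ∧ (∀ x u, k x u ≤ L) ∧ (∀ x u, k x u ≠ 0 → u ∈ A x) ∧
      (∀ x, ∑ u, k x u ≤ Fintype.card U) ∧ (∀ u, ∑ x, w x * k x u ≤ 2 * ∑ x, w x) ∧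
      ∃ F : Finset U, 2 * (F.card : ℝ) ≤ Fintype.card U ∧
        ∀ x, Fintype.card U ≤ L * (A x \ F).card → ∑ u, k x u = Fintype.card U := by
  classical
  set n : ℝ := (Fintype.card U : ℝ)
  set W : ℝ := ∑ x, w x
  let box : Set (X → U → ℝ) := Set.Icc 0 (fun x u => if u ∈ A x then L else 0)
  let poly : Set (X → U → ℝ) := box ∩
    ({k | ∀ x, ∑ u, k x u ≤ n} ∩ {k | ∀ u, ∑ x, w x * k x u ≤ 2 * W})
  have hcomp : IsCompact poly := by
    refine isCompact_Icc.inter_right (IsClosed.inter ?_ ?_)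
    · simp only [Set.ofPred_forall]
      exact isClosed_iInter fun x => isClosed_le (by fun_prop) continuous_const
    · simp only [Set.ofPred_forall]
      exact isClosed_iInter fun x => isClosed_le (by fun_prop) continuous_const
  have hne : poly.Nonempty := by
    refine ⟨0, ⟨le_refl _, fun x u => ?_⟩, fun x => ?_, fun u => ?_⟩
    · simp only [Pi.zero_apply]
      split_ifs <;> simp [hL]
    · simp [n]
    · simp [hW.le]
  obtain ⟨k, ⟨⟨hk0, hkL⟩, hkn, hkW⟩, hmax⟩ := hcomp.exists_isMaxOn hne
    (f := fun k : X → U → ℝ => ∑ x, ∑ u, k x u) (by fun_prop)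
  have hk0' : ∀ x u, 0 ≤ k x u := fun x u => hk0 x u
  have hkL' : ∀ x u, k x u ≤ if u ∈ A x then L else 0 := fun x u => hkL x u
  simp only [Set.mem_ofPred_eq] at hkn hkW
  refine ⟨k, hk0', fun x u => (hkL' x u).trans (by split_ifs <;> simp [hL]), fun x u h => ?_,
    hkn, hkW, Finset.univ.filter (fun u => ∑ x, w x * k x u = 2 * W), ?_, fun x hx => ?_⟩
  · by_contra hu
    have := hkL' x u
    rw [if_neg hu] at this
    exact h (le_antisymm this (hk0' x u))
  · set F := Finset.univ.filter (fun u => ∑ x, w x * k x u = 2 * W) with hF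
    have h1 : (F.card : ℝ) * (2 * W) ≤ n * W := by
      calc (F.card : ℝ) * (2 * W) = ∑ u ∈ F, ∑ x, w x * k x u := by
            rw [Finset.sum_congr rfl (g := fun _ => 2 * W)]
            · simp
            · intro u hu
              exact (Finset.mem_filter.1 hu).2
        _ ≤ ∑ u, ∑ x, w x * k x u :=
            Finset.sum_le_univ_sum_of_nonneg fun u =>
              Finset.sum_nonneg fun x _ => mul_nonneg (hw x) (hk0' x u)
        _ = ∑ x, w x * ∑ u, k x u := by
            rw [Finset.sum_comm]; simp [Finset.mul_sum]
        _ ≤ ∑ x, w x * n := Finset.sum_le_sum fun x _ => mul_le_mul_of_nonneg_left (hkn x) (hw x)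
        _ = n * W := by rw [← Finset.sum_mul, mul_comm]
    nlinarith
  · set F := Finset.univ.filter (fun u => ∑ x, w x * k x u = 2 * W) with hF
    by_contra hne'
    have hlt : ∑ u, k x u < n := lt_of_le_of_ne (hkn x) hne'
    obtain ⟨u, huA, huL⟩ : ∃ u ∈ A x \ F, k x u < L := by
      by_contra! hall
      have : L * (A x \ F).card ≤ ∑ u, k x u := by
        calc L * ((A x \ F).card : ℝ) = ∑ u ∈ A x \ F, L := by simp [mul_comm]
          _ ≤ ∑ u ∈ A x \ F, k x u := Finset.sum_le_sum hall
          _ ≤ ∑ u, k x u := Finset.sum_le_univ_sum_of_nonneg fun u => hk0' x u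
      linarith
    rw [Finset.mem_sdiff] at huA
    have huF : ∑ x, w x * k x u < 2 * W :=
      lt_of_le_of_ne (hkW u) fun h => huA.2 (by simp [hF, h])
    -- raise the single entry `k x u` by a small amount
    obtain ⟨δ, hδ, hδ1, hδ2, hδ3⟩ : ∃ δ : ℝ, 0 < δ ∧ k x u + δ ≤ L ∧ ∑ u, k x u + δ ≤ n ∧
        ∑ x, w x * k x u + w x * δ ≤ 2 * W := by
      have hwx : 0 < w x + 1 := by linarith [hw x]
      refine ⟨min (L - k x u) (min (n - ∑ u, k x u) ((2 * W - ∑ x, w x * k x u) / (w x + 1))),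
        ?_, ?_, ?_, ?_⟩
      · refine lt_min (by linarith) (lt_min (by linarith) (div_pos (by linarith) hwx))
      · linarith [min_le_left (L - k x u)
          (min (n - ∑ u, k x u) ((2 * W - ∑ x, w x * k x u) / (w x + 1)))]
      · linarith [(min_le_right (L - k x u)
          (min (n - ∑ u, k x u) ((2 * W - ∑ x, w x * k x u) / (w x + 1)))).trans (min_le_left _ _)]
      · set δ := min (L - k x u) (min (n - ∑ u, k x u) ((2 * W - ∑ x, w x * k x u) / (w x + 1)))
        have h1 : δ ≤ (2 * W - ∑ x, w x * k x u) / (w x + 1) :=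
          (min_le_right _ _).trans (min_le_right _ _)
        have h0 : 0 < δ :=
          lt_min (by linarith) (lt_min (by linarith) (div_pos (by linarith) hwx))
        rw [le_div_iff₀ hwx] at h1
        linarith
    let k' : X → U → ℝ := fun x' u' => k x' u' + if x' = x then (if u' = u then δ else 0) else 0
    have hk' : k' ∈ poly := by
      refine ⟨⟨fun x' u' => ?_, fun x' u' => ?_⟩, fun x' => ?_, fun u' => ?_⟩
      · have := hk0' x' u'
        simp only [k', Pi.zero_apply]
        split_ifs <;> linarith
      · by_cases h1 : x' = x
        · by_cases h2 : u' = u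
          · subst h1 h2
            simpa [k', huA.1] using hδ1
          · simpa [k', h2] using hkL' x' u'
        · simpa [k', h1] using hkL' x' u'
      · by_cases h1 : x' = x
        · subst h1
          simpa [k', Finset.sum_add_distrib] using hδ2
        · simpa [k', h1] using hkn x'
      · by_cases h2 : u' = u
        · subst h2
          simpa [k', mul_add, Finset.sum_add_distrib] using hδ3
        · simpa [k', h2] using hkW u'
    have := hmax hk'
    simp only [Set.mem_ofPred_eq, k', Finset.sum_add_distrib] at this
    simp at this
    linarith

/-! ### Rich graphs and kernels -/

/-- What an `ε`-bounded graph without a `c`-sparse `(ε c ^ s n, ε n)`-pair satisfies, `n` being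
the number of vertices: every set `A` that is not too small is richly seen by all but few vertices,
and the exceptional set is even polynomially small in `c` when `A` contains half of the vertices. -/
structure IsRich {U : Type*} [Fintype U] [DecidableEq U] (G : SimpleGraph U) [DecidableRel G.Adj]
    (ε c : ℝ) (s : ℕ) : Prop where
  closedNeighbors : ∀ v, ((Finset.univ.filter fun y => v = y ∨ G.Adj v y).card : ℝ) ≤
    ε * Fintype.card U
  poor_le : ∀ A : Finset U, 2 * ε * c ^ s * Fintype.card U ≤ A.card →
    ((Finset.univ.filter fun y => ((A.filter fun x => G.Adj y x).card : ℝ) < c / 2 * A.card).card : ℝ)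
      ≤ 5 * ε * Fintype.card U
  poor_le_of_half : ∀ B : Finset U, (Fintype.card U : ℝ) ≤ 2 * B.card →
    ((Finset.univ.filter fun y => ((B.filter fun x => G.Adj y x).card : ℝ) < c / 2 * B.card).card : ℝ)
      ≤ ε * c ^ s * Fintype.card U

section
variable {U : Type*} [Fintype U] [DecidableEq U] {G : SimpleGraph U} [DecidableRel G.Adj]
  {ε c : ℝ} {s : ℕ}

theorem half_le_card_compl {F : Finset U} (hF : 2 * (F.card : ℝ) ≤ Fintype.card U) :
    (Fintype.card U : ℝ) ≤ 2 * Fᶜ.card := by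
  have h : F.card + Fᶜ.card = Fintype.card U := Finset.card_add_card_compl F
  have h' : (F.card : ℝ) + Fᶜ.card = Fintype.card U := by exact_mod_cast h
  linarith

/-- A transition kernel along edges that moves the distribution with bounded weight `w` to one of
density at most twice the average, losing little mass. -/
theorem IsRich.exists_edge_kernel (hG : IsRich G ε c s) (hc : 0 < c) {τ M : ℝ}
    (hτ : ε * c ^ s * M ≤ τ / 4) (w : U → ℝ) (hw : ∀ a, 0 ≤ w a) (hwM : ∀ a, w a ≤ M) :
    ∃ k : U → U → ℝ, (∀ a x, 0 ≤ k a x) ∧ (∀ a x, k a x ≤ 4 / c) ∧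
      (∀ a x, k a x ≠ 0 → G.Adj a x) ∧ (∀ a, ∑ x, k a x ≤ Fintype.card U) ∧
      (∀ x, ∑ a, w a * k a x ≤ 2 * ∑ a, w a) ∧
      3 / 4 * Fintype.card U * (∑ a, w a - τ * Fintype.card U) ≤ ∑ a, ∑ x, w a * k a x := by
  set n : ℝ := (Fintype.card U : ℝ)
  have hn : 0 ≤ n := Nat.cast_nonneg _
  by_cases hWτ : ∑ a, w a ≤ τ * n
  · refine ⟨fun _ _ => 0, by simp, fun _ _ => by positivity, by simp, fun _ => by simpa using hn,
      fun _ => by simpa using Finset.sum_nonneg fun a _ => hw a, ?_⟩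
    simp only [mul_zero, Finset.sum_const_zero]
    exact mul_nonpos_of_nonneg_of_nonpos (by positivity) (by linarith)
  push Not at hWτ
  have hpoor : ∀ B : Finset U, n ≤ 2 * B.card → 
      ∑ a ∈ Finset.univ.filter (fun y => ((B.filter fun x => G.Adj y x).card : ℝ) < c / 2 * B.card),
        w a ≤ τ / 4 * n := by
    intro B hB
    have hcard := hG.poor_le_of_half B hB
    set Y := Finset.univ.filter (fun y => ((B.filter fun x => G.Adj y x).card : ℝ) < c / 2 * B.card)
    by_cases hU : Nonempty U
    · obtain ⟨u⟩ := hU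
      have hM : 0 ≤ M := (hw u).trans (hwM u)
      calc ∑ a ∈ Y, w a ≤ ∑ a ∈ Y, M := Finset.sum_le_sum fun a _ => hwM a
        _ = Y.card * M := by simp
        _ ≤ (ε * c ^ s * n) * M := mul_le_mul_of_nonneg_right hcard hM
        _ = (ε * c ^ s * M) * n := by ring
        _ ≤ τ / 4 * n := mul_le_mul_of_nonneg_right hτ hn
    · rw [not_nonempty_iff] at hU
      simp [n, Finset.eq_empty_of_isEmpty Y]
  have hτ0 : ∑ a, w a ≥ 0 := Finset.sum_nonneg fun a _ => hw a
  have hW : 0 < ∑ a, w a := by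
    rcases hτ0.lt_or_eq with h | h
    · exact h
    · exfalso
      have := hpoor Finset.univ (by simp [n]; linarith)
      have h2 : 0 ≤ τ / 4 * n := le_trans (Finset.sum_nonneg fun a _ => hw a) this
      linarith
  obtain ⟨k, hk0, hkL, hks, hkn, hkW, F, hF, hkF⟩ := exists_fractional_assignment w hw hW
    (fun a => Finset.univ.filter fun x => G.Adj a x) (L := 4 / c) (by positivity)
  refine ⟨k, hk0, hkL, fun a x h => by simpa using hks a x h, hkn, hkW, ?_⟩
  have hB := half_le_card_compl hF
  have hY := hpoor Fᶜ hB
  set Y := Finset.univ.filter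
    (fun y => (((Fᶜ).filter fun x => G.Adj y x).card : ℝ) < c / 2 * (Fᶜ).card) with hYdef
  have hgood : ∀ a ∈ Yᶜ, ∑ x, k a x = n := by
    intro a ha
    apply hkF
    simp only [hYdef, Finset.mem_compl, Finset.mem_filter, Finset.mem_univ, true_and, not_lt] at ha
    have hEq : (Finset.univ.filter fun x => G.Adj a x) \ F = (Fᶜ).filter fun x => G.Adj a x := by
      ext x; simp [and_comm]
    rw [hEq, div_mul_eq_mul_div, le_div_iff₀ hc]
    nlinarith
  have hsplit : ∑ a ∈ Y, w a + ∑ a ∈ Yᶜ, w a = ∑ a, w a := Finset.sum_add_sum_compl Y w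
  calc 3 / 4 * n * (∑ a, w a - τ * n) ≤ n * ∑ a ∈ Yᶜ, w a := by
        have hY0 : 0 ≤ ∑ a ∈ Y, w a := Finset.sum_nonneg fun a _ => hw a
        have : 3 / 4 * (∑ a, w a - τ * n) ≤ ∑ a ∈ Yᶜ, w a := by linarith
        calc _ = n * (3 / 4 * (∑ a, w a - τ * n)) := by ring
          _ ≤ _ := mul_le_mul_of_nonneg_left this hn
    _ = ∑ a ∈ Yᶜ, ∑ x, w a * k a x := by
        rw [Finset.mul_sum]
        refine Finset.sum_congr rfl fun a ha => ?_
        rw [← Finset.mul_sum, hgood a ha, mul_comm]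
    _ ≤ ∑ a, ∑ x, w a * k a x :=
        Finset.sum_le_univ_sum_of_nonneg fun a => Finset.sum_nonneg fun x _ =>
          mul_nonneg (hw a) (hk0 a x)

/-- Few tuples have few common neighbours in a large set. -/
theorem IsRich.card_poor_tuples_le (hG : IsRich G ε c s) (hc : 0 < c) (hc1 : c ≤ 1)
    {J : Type*} [Fintype J] [DecidableEq J] (hs : Fintype.card J ≤ s)
    (hε : ε * (4 * 2 ^ Fintype.card J) ≤ 1) (B : Finset U)
    (hB : (Fintype.card U : ℝ) ≤ 2 * B.card) (P : Finset J) :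
    ((Finset.univ.filter fun z : J → U =>
      ((B.filter fun x => ∀ j ∈ P, G.Adj (z j) x).card : ℝ) < (c / 2) ^ P.card * B.card).card : ℝ) ≤
      P.card * (5 * ε) * (Fintype.card U : ℝ) ^ Fintype.card J := by
  set n : ℝ := (Fintype.card U : ℝ)
  have hn : 0 ≤ n := Nat.cast_nonneg _
  induction P using Finset.induction_on with
  | empty => simp
  | insert j P hj ih =>
    have hPcard : P.card ≤ Fintype.card J := Finset.card_le_univ P
    -- the new poor tuples have a coordinate `j` that sees few of the common neighbours
    let S : (J → U) → Finset U := fun z => B.filter fun x => ∀ j ∈ P, G.Adj (z j) x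
    let bad : (J → U) → Prop := fun z => (c / 2) ^ P.card * B.card ≤ (S z).card ∧
      (((S z).filter fun x => G.Adj (z j) x).card : ℝ) < c / 2 * (S z).card
    classical
    have hsub : (Finset.univ.filter fun z : J → U =>
        ((B.filter fun x => ∀ i ∈ insert j P, G.Adj (z i) x).card : ℝ) <
          (c / 2) ^ (insert j P).card * B.card) ⊆
        (Finset.univ.filter fun z : J → U => ((S z).card : ℝ) < (c / 2) ^ P.card * B.card) ∪
          Finset.univ.filter bad := by
      intro z hz
      simp only [Finset.mem_union, Finset.mem_filter, Finset.mem_univ, true_and] at hz ⊢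
      by_cases h : ((S z).card : ℝ) < (c / 2) ^ P.card * B.card
      · exact Or.inl h
      · refine Or.inr ⟨not_lt.1 h, ?_⟩
        have hEq : (S z).filter (fun x => G.Adj (z j) x) =
            B.filter fun x => ∀ i ∈ insert j P, G.Adj (z i) x := by
          ext x
          simp only [S, Finset.mem_filter, Finset.forall_mem_insert]
          tauto
        rw [hEq]
        refine hz.trans_le ?_
        rw [Finset.card_insert_of_notMem hj, pow_succ]
        have := not_lt.1 h
        nlinarith
    have hbad : ((Finset.univ.filter bad).card : ℝ) ≤ 5 * ε * n ^ Fintype.card J := by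
      rcases hn.eq_or_lt with h0 | hpos
      · have : IsEmpty U := by
          rw [← Fintype.card_eq_zero_iff]
          have h0' : (0 : ℝ) = (Fintype.card U : ℝ) := h0
          exact_mod_cast h0'.symm
        have : IsEmpty (J → U) := ⟨fun z => this.elim (z j)⟩
        have hJ : Fintype.card J ≠ 0 := (Fintype.card_pos_iff.2 ⟨j⟩).ne'
        rw [← h0]
        simp [hJ]
      · have hav := sum_sum_update j (fun z : J → U => if bad z then (1 : ℝ) else 0)
        have hle : ∀ z : J → U, ∑ a, (if bad (Function.update z j a) then (1 : ℝ) else 0) ≤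
            5 * ε * n := by
          intro z
          have hS : ∀ a, S (Function.update z j a) = S z := by
            intro a
            refine Finset.filter_congr fun x _ => ?_
            refine forall₂_congr fun i hi => ?_
            rw [Function.update_of_ne (by rintro rfl; exact hj hi)]
          simp only [bad, hS, Function.update_self]
          by_cases hbig : (c / 2) ^ P.card * B.card ≤ (S z).card
          · simp only [hbig, true_and, Finset.sum_boole]
            apply hG.poor_le
            refine le_trans ?_ hbig
            have h1 : c ^ s ≤ c ^ P.card := pow_le_pow_of_le_one hc.le hc1 (hPcard.trans hs)
            have h2 : (2 : ℝ) ^ P.card ≤ 2 ^ Fintype.card J :=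
              pow_le_pow_right₀ (by norm_num) hPcard
            have h3 : 0 < c ^ P.card := by positivity
            have h4 : 0 < (2 : ℝ) ^ P.card := by positivity
            have h5 : 0 < c ^ s := by positivity
            rw [div_pow]
            have h6 : c ^ P.card / 2 ^ P.card * (n / 2) ≤ c ^ P.card / 2 ^ P.card * B.card :=
              mul_le_mul_of_nonneg_left (by linarith) (by positivity)
            refine le_trans ?_ h6
            rw [div_mul_eq_mul_div, le_div_iff₀ h4]
            by_cases hε0 : 0 ≤ ε
            · have h7 : ε * (4 * 2 ^ P.card) ≤ 1 :=
                le_trans (mul_le_mul_of_nonneg_left (by linarith) hε0) hε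
              have h8 : ε * (4 * 2 ^ P.card) * c ^ s ≤ 1 * c ^ P.card :=
                mul_le_mul h7 h1 h5.le (by norm_num)
              nlinarith
            · push Not at hε0
              have : 2 * ε * c ^ s * n * 2 ^ P.card ≤ 0 := by
                have : 0 ≤ c ^ s * n * 2 ^ P.card := by positivity
                nlinarith
              refine this.trans (by positivity)
          · simp only [hbig, false_and, if_false, Finset.sum_const_zero]
            obtain ⟨u⟩ : Nonempty U := by
              rw [← Fintype.card_pos_iff]
              have : (0 : ℝ) < (Fintype.card U : ℝ) := hpos
              exact_mod_cast this
            have h1 : 0 ≤ ε * n := le_trans (Nat.cast_nonneg _) (hG.closedNeighbors u)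
            nlinarith
        have hsum := Finset.sum_le_sum fun z (_ : z ∈ Finset.univ) => hle z
        rw [hav] at hsum
        rw [Finset.sum_boole] at hsum
        simp only [Finset.sum_const, Finset.card_univ, nsmul_eq_mul, Fintype.card_fun,
          Nat.cast_pow] at hsum
        have : n * ((Finset.univ.filter bad).card : ℝ) ≤ n * (5 * ε * n ^ Fintype.card J) := by
          refine hsum.trans (le_of_eq ?_)
          simp only [n]; ring
        exact le_of_mul_le_mul_left this hpos
    calc _ ≤ (((Finset.univ.filter fun z : J → U =>
            ((S z).card : ℝ) < (c / 2) ^ P.card * B.card) ∪ Finset.univ.filter bad).card : ℝ) := by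
          exact_mod_cast Finset.card_le_card hsub
      _ ≤ ((Finset.univ.filter fun z : J → U =>
            ((S z).card : ℝ) < (c / 2) ^ P.card * B.card).card : ℝ) +
            (Finset.univ.filter bad).card := by exact_mod_cast Finset.card_union_le _ _
      _ ≤ P.card * (5 * ε) * n ^ Fintype.card J + 5 * ε * n ^ Fintype.card J := add_le_add ih hbad
      _ = _ := by rw [Finset.card_insert_of_notMem hj]; push_cast; ring

/-- A transition kernel from tuples to their common neighbours that hits no vertex more than twice
as often as the average, and is stochastic up to normalisation at all but few tuples. -/
theorem IsRich.exists_tuple_kernel [Nonempty U] (hG : IsRich G ε c s) (hc : 0 < c) (hc1 : c ≤ 1)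
    (J : Type*) [Fintype J] [DecidableEq J] (hs : Fintype.card J ≤ s)
    (hε : ε * (4 * 2 ^ Fintype.card J) ≤ 1) :
    ∃ k : (J → U) → U → ℝ, (∀ a x, 0 ≤ k a x) ∧
      (∀ a x, k a x ≤ 2 * 2 ^ Fintype.card J * (c ^ Fintype.card J)⁻¹) ∧
      (∀ a x, k a x ≠ 0 → ∀ j, G.Adj (a j) x) ∧ (∀ a, ∑ x, k a x ≤ Fintype.card U) ∧
      (∀ x, ∑ a, k a x ≤ 2 * (Fintype.card U : ℝ) ^ Fintype.card J) ∧
      ∃ bad : Finset (J → U),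
        (bad.card : ℝ) ≤ Fintype.card J * (5 * ε) * (Fintype.card U : ℝ) ^ Fintype.card J ∧
        ∀ a ∉ bad, ∑ x, k a x = Fintype.card U := by
  obtain ⟨k, hk0, hkL, hks, hkn, hkW, F, hF, hkF⟩ := exists_fractional_assignment
    (fun _ : J → U => (1 : ℝ)) (by simp) (by
      have : 0 < Fintype.card U := Fintype.card_pos
      simp only [Finset.sum_const, Finset.card_univ, nsmul_eq_mul, Fintype.card_fun, Nat.cast_pow]
      positivity)
    (fun a => Finset.univ.filter fun x => ∀ j ∈ Finset.univ, G.Adj (a j) x)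
    (L := 2 * 2 ^ Fintype.card J * (c ^ Fintype.card J)⁻¹) (by positivity)
  have hB := half_le_card_compl hF
  refine ⟨k, hk0, hkL, fun a x h => by simpa using hks a x h, hkn, fun x => by simpa using hkW x,
    _, by simpa using hG.card_poor_tuples_le hc hc1 hs hε _ hB Finset.univ, fun a ha => ?_⟩
  apply hkF
  simp only [Finset.mem_filter, Finset.mem_univ, true_and, not_lt, forall_true_left] at ha ⊢
  have hEq : (Finset.univ.filter fun x => ∀ j, G.Adj (a j) x) \ F =
      (Fᶜ).filter fun x => ∀ j, G.Adj (a j) x := by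
    ext x; simp [and_comm]
  rw [hEq]
  have hcd : 0 < c ^ Fintype.card J := by positivity
  have h2d : (0 : ℝ) < 2 ^ Fintype.card J := by positivity
  rw [← div_eq_mul_inv, div_mul_eq_mul_div, le_div_iff₀ hcd]
  rw [div_pow, div_mul_eq_mul_div, div_le_iff₀ h2d] at ha
  nlinarith

end

/-! ### Embedding patterns in rich graphs -/

/-- An instruction for embedding finitely many vertices one after the other, in the order of `rank`:
each vertex is to be adjacent to its parents, and no coincidences or adjacencies may occur between
vertices that are not linked. A `strong` vertex has exactly one parent. The other vertices have any
number of pairwise unlinked parents, and are linked to every earlier vertex that is linked to one of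
their parents, apart from the parents themselves. -/
structure EmbeddingPattern (I : Type*) where
  /-- The order in which the vertices are embedded. -/
  rank : I → ℕ
  rank_injective : Function.Injective rank
  /-- `par i j` says that `j` is a parent of `i`. -/
  par : I → I → Prop
  rank_lt_of_par : ∀ {i j}, par i j → rank j < rank i
  /-- The vertices whose position is controlled given all vertices other than the parent. -/
  strong : I → Prop
  exists_parent_of_strong : ∀ {i}, strong i → ∃ h, ∀ j, par i j ↔ j = h
  /-- The pairs whose joint distribution is not controlled. -/
  link : I → I → Prop
  link_symm : ∀ {i j}, link i j → link j i
  link_of_par : ∀ {i j}, par i j → link i j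
  not_link_of_par_of_par : ∀ {i j j'}, ¬ strong i → par i j → par i j' → j ≠ j' → ¬ link j j'
  link_of_par_of_link : ∀ {i j t}, ¬ strong i → par i j → rank t < rank i → ¬ par i t →
    link j t → link i t

theorem forall_mem_iff_forall_mem_erase {I : Type*} [DecidableEq I] {S : Finset I} {i : I}
    (hi : i ∈ S) {p : I → Prop} : (∀ j ∈ S, p j) ↔ (∀ j ∈ S.erase i, p j) ∧ p i := by
  conv_lhs => rw [← Finset.insert_erase hi, Finset.forall_mem_insert]
  exact and_comm

namespace EmbeddingPattern

theorem rank_lt_of_mem_erase {I : Type*} [DecidableEq I] {P : EmbeddingPattern I} {m : ℕ} {i : I} (hi : P.rank i = m) {S : Finset I}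
    (hS : ∀ j ∈ S, P.rank j < m + 1) : ∀ j ∈ S.erase i, P.rank j < m := by
  intro j hj
  rw [Finset.mem_erase] at hj
  have := hS j hj.2
  have : P.rank j ≠ m := fun h => hj.1 (P.rank_injective (h.trans hi.symm))
  omega

variable {I : Type*} [Fintype I] [DecidableEq I] (P : EmbeddingPattern I)

/-- The vertices of rank less than `m` have been embedded at random: `f` is the density of the
embedding relative to the uniform distribution on all maps from `I` to the vertex set, up to
normalisation. On a set of pairwise unlinked embedded vertices the marginal density is at most `C`.
-/
structure IsPartialDensity {U : Type*} [Fintype U] [DecidableEq U] (G : SimpleGraph U) (c : ℝ)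
    (m : ℕ) (a C K : ℝ) (T : ℕ) (f : (I → U) → ℝ) : Prop where
  nonneg : ∀ z, 0 ≤ f z
  le : ∀ z, f z ≤ K * (c ^ T)⁻¹
  update_eq : ∀ z i u, m ≤ P.rank i → f (Function.update z i u) = f z
  adj : ∀ z, f z ≠ 0 → ∀ i j, P.rank i < m → P.par i j → G.Adj (z j) (z i)
  mass : a * (Fintype.card U : ℝ) ^ Fintype.card I ≤ ∑ z, f z
  marginal : ∀ S : Finset I, (∀ i ∈ S, P.rank i < m) → (∀ i ∈ S, ∀ j ∈ S, i ≠ j → ¬ P.link i j) →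
    ∀ y : I → U, (∑ z : I → U, if ∀ i ∈ S, z i = y i then f z else 0) *
      (Fintype.card U : ℝ) ^ S.card ≤ C * (Fintype.card U : ℝ) ^ Fintype.card I

section
variable {P} {U : Type*} [Fintype U] [DecidableEq U] {G : SimpleGraph U} {c : ℝ}
    {m : ℕ} {a C K : ℝ} {T : ℕ} {f : (I → U) → ℝ}

theorem IsPartialDensity.succ_of_forall_ne (hf : P.IsPartialDensity G c m a C K T f)
    (hm : ∀ i, P.rank i ≠ m) : P.IsPartialDensity G c (m + 1) a C K T f where
  nonneg := hf.nonneg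
  le := hf.le
  update_eq z i u h := hf.update_eq z i u (by omega)
  adj z h i j hi hij := hf.adj z h i j (by have := hm i; omega) hij
  mass := hf.mass
  marginal S hS hS' y := hf.marginal S (fun i hi => by have := hm i; have := hS i hi; omega) hS' y

/-- The marginal bound for sets that avoid the vertex `i` embedded last. -/
theorem IsPartialDensity.marginal_mul_kernel_le [Nonempty U]
    (hf : P.IsPartialDensity G c m a C K T f) {i : I} (hi : P.rank i = m)
    (k : (I → U) → U → ℝ) (hk : ∀ z u x, k (Function.update z i u) x = k z x)
    (hkn : ∀ z, ∑ x, k z x ≤ Fintype.card U)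
    {S : Finset I} (hS : ∀ j ∈ S, P.rank j < m + 1)
    (hS' : ∀ i ∈ S, ∀ j ∈ S, i ≠ j → ¬ P.link i j) (hiS : i ∉ S) (y : I → U) :
    (∑ z : I → U, if ∀ j ∈ S, z j = y j then f z * k z (z i) else 0) *
      (Fintype.card U : ℝ) ^ S.card ≤ C * (Fintype.card U : ℝ) ^ Fintype.card I := by
  have hn : (0 : ℝ) < Fintype.card U := by exact_mod_cast Fintype.card_pos
  refine le_trans (mul_le_mul_of_nonneg_right ?_ (by positivity)) (hf.marginal S ?_ hS' y)
  · have hav := sum_sum_update i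
      (fun z : I → U => if ∀ j ∈ S, z j = y j then f z * k z (z i) else 0)
    refine le_of_mul_le_mul_left (hav.symm.le.trans ?_) hn
    rw [Finset.mul_sum]
    refine Finset.sum_le_sum fun z _ => ?_
    have hind : ∀ u, (∀ j ∈ S, Function.update z i u j = y j) ↔ ∀ j ∈ S, z j = y j := fun u =>
      forall₂_congr fun j hj => by rw [Function.update_of_ne (by rintro rfl; exact hiS hj)]
    simp only [hind, hf.update_eq z i _ hi.ge, hk, Function.update_self]
    split_ifs with h
    · rw [← Finset.mul_sum, mul_comm]
      exact mul_le_mul_of_nonneg_right (hkn z) (hf.nonneg z)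
    · simp
  · intro j hj
    have := hS j hj
    have : P.rank j ≠ m := fun h => hiS (P.rank_injective (h.trans hi.symm) ▸ hj)
    omega

/-- Embedding a strong vertex next to its parent. -/
theorem IsPartialDensity.exists_succ_of_strong [Nonempty U] [DecidableRel G.Adj] {ε : ℝ} {s : ℕ}
    (hG : IsRich G ε c s) (hc : 0 < c) (hc1 : c ≤ 1) (hε : 0 < ε)
    (hf : P.IsPartialDensity G c m a C K T f) (ha : 0 < a) (hC : 0 ≤ C) (hK : 0 ≤ K)
    (hεK : 16 * ε * K ≤ a) (hs : T ≤ s) {i : I} (hi : P.rank i = m) (hst : P.strong i) :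
    ∃ f', P.IsPartialDensity G c (m + 1) (a / 2) (2 * C) (4 * K) (T + 1) f' := by
  have hn : (0 : ℝ) < Fintype.card U := by exact_mod_cast Fintype.card_pos
  obtain ⟨h, hpar⟩ := P.exists_parent_of_strong hst
  have hih : P.par i h := (hpar h).2 rfl
  have hlt : P.rank h < m := hi ▸ P.rank_lt_of_par hih
  have hne : h ≠ i := by rintro rfl; omega
  have hτ : ε * c ^ s * (K * (c ^ T)⁻¹) ≤ a / 4 / 4 := by
    have h1 : c ^ s * (c ^ T)⁻¹ ≤ 1 := by
      rw [← div_eq_mul_inv, div_le_one (by positivity)]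
      exact pow_le_pow_of_le_one hc.le hc1 hs
    have h2 : ε * K * (c ^ s * (c ^ T)⁻¹) ≤ ε * K * 1 :=
      mul_le_mul_of_nonneg_left h1 (by positivity)
    linarith
  have hker : ∀ w : U → ℝ, ∃ k : U → U → ℝ, (∀ b, 0 ≤ w b) → (∀ b, w b ≤ K * (c ^ T)⁻¹) → _ :=
    fun w => by
      by_cases h1 : (∀ b, 0 ≤ w b) ∧ ∀ b, w b ≤ K * (c ^ T)⁻¹
      · obtain ⟨k, hk⟩ := hG.exists_edge_kernel hc hτ w h1.1 h1.2
        exact ⟨k, fun _ _ => hk⟩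
      · exact ⟨0, fun h2 h3 => absurd ⟨h2, h3⟩ h1⟩
  choose k hk using hker
  let w : (I → U) → U → ℝ := fun z b => f (Function.update z h b)
  have hkw := fun z => hk (w z) (fun b => hf.nonneg _) (fun b => hf.le _)
  have hw_upd : ∀ z j u, m ≤ P.rank j → w (Function.update z j u) = w z := by
    intro z j u hj
    funext b
    have hjh : j ≠ h := by rintro rfl; omega
    simp only [w]
    rw [Function.update_comm hjh, hf.update_eq _ _ _ hj]
  have hw_self : ∀ z u, w (Function.update z h u) = w z := by
    intro z u
    funext b
    simp [w]
  refine ⟨fun z => f z * k (w z) (z h) (z i), ?_, ?_, ?_, ?_, ?_, ?_⟩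
  · exact fun z => mul_nonneg (hf.nonneg z) ((hkw z).1 _ _)
  · intro z
    calc f z * k (w z) (z h) (z i) ≤ K * (c ^ T)⁻¹ * (4 / c) :=
          mul_le_mul (hf.le z) ((hkw z).2.1 _ _) ((hkw z).1 _ _) (by positivity)
      _ = 4 * K * (c ^ (T + 1))⁻¹ := by rw [pow_succ, mul_inv]; ring
  · intro z j u hj
    have hjh : h ≠ j := by rintro rfl; omega
    have hji : i ≠ j := by rintro rfl; omega
    simp only [hw_upd z j u (by omega), hf.update_eq z j u (by omega),
      Function.update_of_ne hjh, Function.update_of_ne hji]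
  · intro z hz j l hj hjl
    by_cases hji : j = i
    · subst hji
      rw [(hpar l).1 hjl]
      exact (hkw z).2.2.1 _ _ (right_ne_zero_of_mul hz)
    · exact hf.adj z (left_ne_zero_of_mul hz) j l
        (rank_lt_of_mem_erase hi (S := {j}) (by simpa using hj) j (by simp [hji])) hjl
  · -- resample both `h` and `i`
    have hav1 := sum_sum_update i (fun z : I → U => f z * k (w z) (z h) (z i))
    have hav2 := sum_sum_update h
      (fun z : I → U => ∑ x, f (Function.update z i x) * k (w (Function.update z i x))
        (Function.update z i x h) (Function.update z i x i))
    have hav3 := sum_sum_update h f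
    simp only [hf.update_eq _ i _ hi.ge, hw_upd _ i _ hi.ge, Function.update_of_ne hne,
      Function.update_self, hw_self] at hav1 hav2
    have hle : ∀ z, 3 / 4 * (Fintype.card U : ℝ) * (∑ b, w z b - a / 4 * Fintype.card U) ≤
        ∑ b, ∑ x, w z b * k (w z) b x := fun z => (hkw z).2.2.2.2.2
    have hsum := Finset.sum_le_sum fun z (_ : z ∈ Finset.univ) => hle z
    rw [← Finset.mul_sum, Finset.sum_sub_distrib, hav3] at hsum
    simp only [Finset.sum_const, Finset.card_univ, nsmul_eq_mul, Fintype.card_fun,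
      Nat.cast_pow] at hsum
    have htot := hsum.trans_eq (hav2.trans (by rw [hav1]))
    have hmass := hf.mass
    set n : ℝ := (Fintype.card U : ℝ)
    set N : ℝ := n ^ Fintype.card I
    have hN : 0 < N := by positivity
    have h1 : n * n * (3 / 4 * (∑ z, f z - a / 4 * N)) ≤
        n * n * ∑ z, f z * k (w z) (z h) (z i) := by
      refine le_trans (le_of_eq ?_) (htot.trans_eq ?_) <;> ring
    have h2 := le_of_mul_le_mul_left h1 (by positivity)
    nlinarith
  · intro S hS hS' y
    by_cases hiS : i ∈ S
    · have hhS : h ∉ S := fun hh => hS' i hiS h hh hne.symm (P.link_of_par hih)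
      have hmarg := hf.marginal (S.erase i) (rank_lt_of_mem_erase hi hS)
        (fun j hj l hl => hS' j (Finset.mem_of_mem_erase hj) l (Finset.mem_of_mem_erase hl)) y
      have hcard : S.card = (S.erase i).card + 1 := (Finset.card_erase_add_one hiS).symm
      have hSi : ∀ z x, (∀ j ∈ S, Function.update z i x j = y j) ↔
          (∀ j ∈ S.erase i, z j = y j) ∧ x = y i := fun z x => by
        rw [forall_mem_iff_forall_mem_erase hiS, Function.update_self]
        exact and_congr_left' (forall₂_congr fun j hj => by
          rw [Function.update_of_ne (Finset.ne_of_mem_erase hj)])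
      have hSh : ∀ z b, (∀ j ∈ S.erase i, Function.update z h b j = y j) ↔
          ∀ j ∈ S.erase i, z j = y j := fun z b => forall₂_congr fun j hj => by
        rw [Function.update_of_ne (by rintro rfl; exact hhS (Finset.mem_of_mem_erase hj))]
      have hav1 := sum_sum_update i (fun z : I → U =>
        if ∀ j ∈ S, z j = y j then f z * k (w z) (z h) (z i) else 0)
      have hav2 := sum_sum_update h (fun z : I → U =>
        if ∀ j ∈ S.erase i, z j = y j then f z * k (w z) (z h) (y i) else 0)
      have hav3 := sum_sum_update h (fun z : I → U =>
        if ∀ j ∈ S.erase i, z j = y j then f z else 0)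
      simp only [hSi, hf.update_eq _ i _ hi.ge, hw_upd _ i _ hi.ge, Function.update_of_ne hne,
        Function.update_self, ite_and] at hav1
      have hav1' : ∀ z : I → U, (∑ x, if ∀ j ∈ S.erase i, z j = y j then
          if x = y i then f z * k (w z) (z h) x else 0 else 0) =
          if ∀ j ∈ S.erase i, z j = y j then f z * k (w z) (z h) (y i) else 0 := fun z => by
        split_ifs <;> simp
      simp only [hav1'] at hav1
      simp only [hSh, hw_self, Function.update_self] at hav2 hav3
      have hle : ∀ z : I → U, (∑ b, if ∀ j ∈ S.erase i, z j = y j then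
          w z b * k (w z) b (y i) else 0) ≤
          2 * ∑ b, if ∀ j ∈ S.erase i, z j = y j then w z b else 0 := fun z => by
        split_ifs
        · exact (hkw z).2.2.2.2.1 _
        · simp
      have hsum := Finset.sum_le_sum fun z (_ : z ∈ Finset.univ) => hle z
      rw [← Finset.mul_sum, hav2, hav3, hav1] at hsum
      set n : ℝ := (Fintype.card U : ℝ)
      have h1 : n * (∑ z, if ∀ j ∈ S, z j = y j then f z * k (w z) (z h) (z i) else 0) ≤
          2 * ∑ z, if ∀ j ∈ S.erase i, z j = y j then f z else 0 :=
        le_of_mul_le_mul_left (hsum.trans_eq (by ring)) hn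
      rw [hcard, pow_succ]
      have h2 := mul_le_mul_of_nonneg_right h1 (by positivity : 0 ≤ n ^ (S.erase i).card)
      linarith
    · have := hf.marginal_mul_kernel_le hi (fun z x => k (w z) (z h) x)
        (fun z u x => by simp only [hw_upd z i u hi.ge, Function.update_of_ne hne])
        (fun z => (hkw z).2.2.2.1 _) hS hS' hiS y
      refine this.trans (mul_le_mul_of_nonneg_right (by linarith) (by positivity))

end

end EmbeddingPattern

namespace EmbeddingPattern

variable {I : Type*} [Fintype I] [DecidableEq I]

section
variable {P : EmbeddingPattern I} {U : Type*} [Fintype U] [DecidableEq U] {G : SimpleGraph U} {c : ℝ}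
    {m : ℕ} {a C K : ℝ} {T : ℕ} {f : (I → U) → ℝ}

/-- The marginal bound, with the values prescribed by a function on the index set. -/
theorem IsPartialDensity.marginal_subtype_le [Nonempty U]
    (hf : P.IsPartialDensity G c m a C K T f) {S Q : Finset I} (hSQ : Disjoint S Q)
    (hS : ∀ i ∈ S ∪ Q, P.rank i < m) (hS' : ∀ i ∈ S ∪ Q, ∀ j ∈ S ∪ Q, i ≠ j → ¬ P.link i j)
    (y : I → U) (b : Q → U) :
    (∑ z : I → U, if (∀ i ∈ S, z i = y i) ∧ (fun j : Q => z j) = b then f z else 0) *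
      (Fintype.card U : ℝ) ^ (S.card + Q.card) ≤ C * (Fintype.card U : ℝ) ^ Fintype.card I := by
  have := hf.marginal (S ∪ Q) hS hS' (fun i => if h : i ∈ Q then b ⟨i, h⟩ else y i)
  rw [Finset.card_union_of_disjoint hSQ] at this
  have hiff : ∀ z : I → U, ((∀ i ∈ S ∪ Q, z i = if h : i ∈ Q then b ⟨i, h⟩ else y i) ↔
      (∀ i ∈ S, z i = y i) ∧ (fun j : Q => z j) = b) := by
    intro z
    rw [Finset.forall_mem_union]
    refine and_congr (forall₂_congr fun i hi => ?_) ?_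
    · rw [dif_neg (Finset.disjoint_left.1 hSQ hi)]
    · constructor
      · intro h
        funext j
        have := h j j.2
        rwa [dif_pos j.2] at this
      · rintro rfl i hi
        simp [hi]
  simpa only [hiff] using this

/-- Embedding a vertex that is not strong, as a common neighbour of its parents. -/
theorem IsPartialDensity.exists_succ_of_not_strong [Nonempty U] [DecidableRel G.Adj] {ε : ℝ} {s : ℕ}
    (hG : IsRich G ε c s) (hc : 0 < c) (hc1 : c ≤ 1)
    (hf : P.IsPartialDensity G c m a C K T f) (hC : 0 ≤ C) (hK : 0 ≤ K)
    {i : I} (hi : P.rank i = m) (hst : ¬ P.strong i) {Q : Finset I} (hQ : ∀ j, P.par i j ↔ j ∈ Q)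
    (hεC : 10 * Q.card * ε * C ≤ a) (hs : Q.card ≤ s) (hε4 : ε * (4 * 2 ^ Q.card) ≤ 1) :
    ∃ f', P.IsPartialDensity G c (m + 1) (a / 2) (2 * C) (2 * 2 ^ Q.card * K) (T + Q.card) f' := by
  have hn : (0 : ℝ) < Fintype.card U := by exact_mod_cast Fintype.card_pos
  have hQlt : ∀ j ∈ Q, P.rank j < m := fun j hj => hi ▸ P.rank_lt_of_par ((hQ j).2 hj)
  have hiQ : i ∉ Q := fun h => by have := hQlt i h; omega
  have hQlink : ∀ j ∈ Q, ∀ l ∈ Q, j ≠ l → ¬ P.link j l := fun j hj l hl hjl =>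
    P.not_link_of_par_of_par hst ((hQ j).2 hj) ((hQ l).2 hl) hjl
  have hQc : Fintype.card Q = Q.card := Fintype.card_coe Q
  obtain ⟨k, hk0, hkL, hks, hkn, hkW, bad, hbad, hkbad⟩ :=
    hG.exists_tuple_kernel hc hc1 Q (by rwa [hQc]) (by rwa [hQc])
  rw [hQc] at hkL hkW hbad
  let res : (I → U) → Q → U := fun z j => z j
  have hres : ∀ z j u, m ≤ P.rank j → res (Function.update z j u) = res z := by
    intro z j u hj
    funext l
    have hlj : (l : I) ≠ j := by
      intro h
      have := hQlt l l.2
      rw [h] at this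
      omega
    simp [res, Function.update_of_ne hlj]
  refine ⟨fun z => f z * k (res z) (z i), ?_, ?_, ?_, ?_, ?_, ?_⟩
  · exact fun z => mul_nonneg (hf.nonneg z) (hk0 _ _)
  · intro z
    calc f z * k (res z) (z i) ≤ K * (c ^ T)⁻¹ * (2 * 2 ^ Q.card * (c ^ Q.card)⁻¹) :=
          mul_le_mul (hf.le z) (hkL _ _) (hk0 _ _) (by positivity)
      _ = 2 * 2 ^ Q.card * K * (c ^ (T + Q.card))⁻¹ := by rw [pow_add, mul_inv]; ring
  · intro z j u hj
    have hji : i ≠ j := by rintro rfl; omega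
    simp only [hres z j u (by omega), hf.update_eq z j u (by omega), Function.update_of_ne hji]
  · intro z hz j l hj hjl
    by_cases hji : j = i
    · subst hji
      exact hks _ _ (right_ne_zero_of_mul hz) ⟨l, (hQ l).1 hjl⟩
    · exact hf.adj z (left_ne_zero_of_mul hz) j l
        (rank_lt_of_mem_erase hi (S := {j}) (by simpa using hj) j (by simp [hji])) hjl
  · have hav := sum_sum_update i (fun z : I → U => f z * k (res z) (z i))
    simp only [hf.update_eq _ i _ hi.ge, hres _ i _ hi.ge, Function.update_self,
      ← Finset.mul_sum] at hav
    have hle : ∀ z, f z * Fintype.card U - Fintype.card U * (if res z ∈ bad then f z else 0) ≤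
        f z * ∑ x, k (res z) x := fun z => by
      split_ifs with h
      · rw [mul_comm, sub_self]
        exact mul_nonneg (hf.nonneg z) (Finset.sum_nonneg fun x _ => hk0 _ _)
      · rw [hkbad _ h]; simp
    have hsum := Finset.sum_le_sum fun z (_ : z ∈ Finset.univ) => hle z
    rw [hav, Finset.sum_sub_distrib, ← Finset.sum_mul, ← Finset.mul_sum, mul_comm, ← mul_sub] at hsum
    have hsum' := le_of_mul_le_mul_left hsum hn
    -- the weight of the maps whose restriction to the parents is bad
    have hlost : (∑ z, if res z ∈ bad then f z else 0) ≤
        5 * Q.card * ε * C * (Fintype.card U : ℝ) ^ Fintype.card I := by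
      have h1 : ∀ z, (if res z ∈ bad then f z else 0) =
          ∑ b ∈ bad, if (fun j : Q => z j) = b then f z else 0 := by
        intro z
        simp [res]
      have h2 : ∀ b, (∑ z : I → U, if (fun j : Q => z j) = b then f z else 0) * (Fintype.card U : ℝ) ^ Q.card ≤
          C * (Fintype.card U : ℝ) ^ Fintype.card I := by
        intro b
        have := hf.marginal_subtype_le (S := ∅) (Finset.disjoint_empty_left Q) (by simpa using hQlt)
          (by simpa using hQlink) (fun _ => Classical.arbitrary U) b
        simpa using this
      simp only [h1]
      rw [Finset.sum_comm]
      have h3 := Finset.sum_le_sum fun b (_ : b ∈ bad) => h2 b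
      rw [← Finset.sum_mul] at h3
      refine le_of_mul_le_mul_right (h3.trans ?_)
        (by positivity : 0 < (Fintype.card U : ℝ) ^ Q.card)
      rw [Finset.sum_const, nsmul_eq_mul]
      have h4 := mul_le_mul_of_nonneg_right hbad
        (by positivity : 0 ≤ C * (Fintype.card U : ℝ) ^ Fintype.card I)
      linarith
    have hN : 0 ≤ (Fintype.card U : ℝ) ^ Fintype.card I := by positivity
    have hmass := hf.mass
    have h5 := mul_le_mul_of_nonneg_right hεC hN
    linarith
  · intro S hS hS' y
    by_cases hiS : i ∈ S
    · have hdisj : Disjoint (S.erase i) Q := by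
        rw [Finset.disjoint_left]
        intro j hj hjQ
        rw [Finset.mem_erase] at hj
        exact hS' i hiS j hj.2 (Ne.symm hj.1) (P.link_of_par ((hQ j).2 hjQ))
      have hlt := rank_lt_of_mem_erase hi hS
      have hcross : ∀ j ∈ S.erase i, ∀ l ∈ Q, ¬ P.link l j := fun j hj l hl hlj => by
        have hjQ := Finset.disjoint_left.1 hdisj hj
        have h := P.link_of_par_of_link hst ((hQ l).2 hl) (hi ▸ hlt j hj)
          (fun h => hjQ ((hQ j).1 h)) hlj
        rw [Finset.mem_erase] at hj
        exact hS' i hiS j hj.2 (Ne.symm hj.1) h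
      have hmarg := hf.marginal_subtype_le hdisj
        (fun j hj => (Finset.mem_union.1 hj).elim (hlt j) (hQlt j)) (fun j hj l hl hjl => by
          rcases Finset.mem_union.1 hj with hj | hj <;> rcases Finset.mem_union.1 hl with hl | hl
          · exact hS' j (Finset.mem_of_mem_erase hj) l (Finset.mem_of_mem_erase hl) hjl
          · exact fun h => hcross j hj l hl (P.link_symm h)
          · exact hcross l hl j hj
          · exact hQlink j hj l hl hjl) y
      have hcard : S.card = (S.erase i).card + 1 := (Finset.card_erase_add_one hiS).symm
      have hSi : ∀ z x, (∀ j ∈ S, Function.update z i x j = y j) ↔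
          (∀ j ∈ S.erase i, z j = y j) ∧ x = y i := fun z x => by
        rw [forall_mem_iff_forall_mem_erase hiS, Function.update_self]
        exact and_congr_left' (forall₂_congr fun j hj => by
          rw [Function.update_of_ne (Finset.ne_of_mem_erase hj)])
      have hav := sum_sum_update i (fun z : I → U =>
        if ∀ j ∈ S, z j = y j then f z * k (res z) (z i) else 0)
      simp only [hSi, hf.update_eq _ i _ hi.ge, hres _ i _ hi.ge, Function.update_self,
        ite_and] at hav
      have hav' : ∀ z : I → U, (∑ x, if ∀ j ∈ S.erase i, z j = y j then
          if x = y i then f z * k (res z) x else 0 else 0) =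
          ∑ b : Q → U, k b (y i) *
            if (∀ j ∈ S.erase i, z j = y j) ∧ (fun j : Q => z j) = b then f z else 0 := fun z => by
        by_cases h : ∀ j ∈ S.erase i, z j = y j
        · simp only [if_pos h, and_iff_right h]
          simp [res, mul_comm]
        · rw [Finset.sum_eq_zero (fun x _ => if_neg h),
            Finset.sum_eq_zero (fun b _ => by rw [if_neg (fun hb => h hb.1), mul_zero])]
      simp only [hav'] at hav
      rw [Finset.sum_comm] at hav
      simp only [← Finset.mul_sum] at hav
      set n : ℝ := (Fintype.card U : ℝ)
      set N : ℝ := n ^ Fintype.card I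
      have h1 := Finset.sum_le_sum fun b (_ : b ∈ Finset.univ) =>
        mul_le_mul_of_nonneg_left (hmarg b) (hk0 b (y i))
      simp only [← mul_assoc (k _ _) (∑ _, _)] at h1
      rw [← Finset.sum_mul, hav, ← Finset.sum_mul] at h1
      have h2 := mul_le_mul_of_nonneg_right (hkW (y i)) (by positivity : 0 ≤ C * N)
      have h3 := h1.trans h2
      rw [hcard]
      refine le_of_mul_le_mul_right ?_ (by positivity : 0 < n ^ Q.card)
      refine le_trans (le_of_eq ?_) (h3.trans_eq ?_)
      · ring
      · ring
    · have := hf.marginal_mul_kernel_le hi (fun z x => k (res z) x)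
        (fun z u x => by simp only [hres z i u hi.ge]) (fun z => hkn _) hS hS' hiS y
      refine this.trans (mul_le_mul_of_nonneg_right (by linarith) (by positivity))

end

end EmbeddingPattern

namespace EmbeddingPattern

variable {I : Type*} [Fintype I] [DecidableEq I]

/-- Iterating the two embedding steps: the first `m` ranks can be embedded with constants that depend
only on the pattern. -/
theorem exists_isPartialDensity (P : EmbeddingPattern I) (m : ℕ) :
    ∃ (a C K ε₀ : ℝ) (T s₀ : ℕ), 0 < a ∧ 0 ≤ C ∧ 0 ≤ K ∧ 0 < ε₀ ∧
      ∀ (U : Type*) [Fintype U] [DecidableEq U] [Nonempty U] (G : SimpleGraph U)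
        [DecidableRel G.Adj] (ε c : ℝ) (s : ℕ), 0 < ε → ε ≤ ε₀ → s₀ ≤ s → 0 < c → c ≤ 1 →
        IsRich G ε c s → ∃ f, P.IsPartialDensity G c m a C K T f := by
  induction m with
  | zero =>
    refine ⟨1, 1, 1, 1, 0, 0, by simp, by simp, by simp, by simp, ?_⟩
    intro U _ _ _ G _ ε c s _ _ _ _ _ _
    refine ⟨fun _ => 1, by simp, by simp, by simp, by simp, by simp, fun S hS _ y => ?_⟩
    obtain rfl : S = ∅ := Finset.eq_empty_of_forall_notMem fun i hi => by simpa using hS i hi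
    simp
  | succ m ih =>
    obtain ⟨a, C, K, ε₀, T, s₀, ha, hC, hK, hε₀, h⟩ := ih
    by_cases hm : ∃ i, P.rank i = m
    · obtain ⟨i, hi⟩ := hm
      by_cases hst : P.strong i
      · refine ⟨a / 2, 2 * C, 4 * K, min ε₀ (a / (16 * K + 1)), T + 1, max s₀ T, by positivity,
          by positivity, by positivity, by positivity, ?_⟩
        intro U _ _ _ G _ ε c s hε hεε hs hc hc1 hG
        obtain ⟨f, hf⟩ := h U G ε c s hε (hεε.trans (min_le_left _ _))
          ((le_max_left _ _).trans hs) hc hc1 hG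
        refine hf.exists_succ_of_strong hG hc hc1 hε ha hC hK ?_ ((le_max_right _ _).trans hs) hi hst
        have h1 := hεε.trans (min_le_right _ _)
        rw [le_div_iff₀ (by positivity)] at h1
        linarith
      · classical
        set Q := Finset.univ.filter (P.par i) with hQ
        refine ⟨a / 2, 2 * C, 2 * 2 ^ Q.card * K,
          min ε₀ (min (a / (10 * Q.card * C + 1)) (1 / (4 * 2 ^ Q.card))), T + Q.card,
          max s₀ Q.card, by positivity, by positivity, by positivity, by positivity, ?_⟩
        intro U _ _ _ G _ ε c s hε hεε hs hc hc1 hG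
        obtain ⟨f, hf⟩ := h U G ε c s hε (hεε.trans (min_le_left _ _))
          ((le_max_left _ _).trans hs) hc hc1 hG
        refine hf.exists_succ_of_not_strong hG hc hc1 hC hK hi hst (Q := Q) (by simp [hQ]) ?_
          ((le_max_right _ _).trans hs) ?_
        · have h1 := (hεε.trans (min_le_right _ _)).trans (min_le_left _ _)
          rw [le_div_iff₀ (by positivity)] at h1
          linarith
        · have h1 := (hεε.trans (min_le_right _ _)).trans (min_le_right _ _)
          rwa [le_div_iff₀ (by positivity)] at h1
    · push Not at hm
      refine ⟨a, C, K, ε₀, T, s₀, ha, hC, hK, hε₀, ?_⟩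
      intro U _ _ _ G _ ε c s hε hεε hs hc hc1 hG
      obtain ⟨f, hf⟩ := h U G ε c s hε hεε hs hc hc1 hG
      exact ⟨f, hf.succ_of_forall_ne hm⟩

/-- Two unlinked vertices rarely coincide or become adjacent, as closed neighbourhoods are small. -/
theorem IsPartialDensity.sum_conflict_le {P : EmbeddingPattern I} {U : Type*} [Fintype U]
    [DecidableEq U] [Nonempty U] {G : SimpleGraph U} [DecidableRel G.Adj] {ε c : ℝ} {s m : ℕ}
    {a C K : ℝ} {T : ℕ} {f : (I → U) → ℝ} (hf : P.IsPartialDensity G c m a C K T f) (hC : 0 ≤ C)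
    (hG : IsRich G ε c s) (hm : ∀ i, P.rank i < m) {i j : I} (hij : i ≠ j) (hl : ¬ P.link i j) :
    (∑ z : I → U, if z i = z j ∨ G.Adj (z i) (z j) then f z else 0) ≤
      C * ε * (Fintype.card U : ℝ) ^ Fintype.card I := by
  have hn : (0 : ℝ) < Fintype.card U := by exact_mod_cast Fintype.card_pos
  let E : Finset (U × U) := Finset.univ.filter fun p => p.1 = p.2 ∨ G.Adj p.1 p.2
  have hE : (E.card : ℝ) ≤ Fintype.card U * (ε * Fintype.card U) := by
    have h1 : (E.card : ℝ) =
        ∑ v, ((Finset.univ.filter fun y => v = y ∨ G.Adj v y).card : ℝ) := by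
      simp only [E, ← Finset.sum_boole]
      rw [Fintype.sum_prod_type]
    rw [h1]
    refine (Finset.sum_le_sum fun v _ => hG.closedNeighbors v).trans ?_
    simp
  have h1 : ∀ z : I → U, (if z i = z j ∨ G.Adj (z i) (z j) then f z else 0) =
      ∑ p ∈ E, if z i = p.1 ∧ z j = p.2 then f z else 0 := by
    intro z
    have : ∀ p : U × U, (z i = p.1 ∧ z j = p.2) ↔ p = (z i, z j) := fun p => by
      rw [Prod.ext_iff]; simp [eq_comm]
    simp only [this, Finset.sum_ite_eq', E, Finset.mem_filter, Finset.mem_univ, true_and]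
  have h2 : ∀ p : U × U, (∑ z : I → U, if z i = p.1 ∧ z j = p.2 then f z else 0) *
      (Fintype.card U : ℝ) ^ 2 ≤ C * (Fintype.card U : ℝ) ^ Fintype.card I := by
    intro p
    have := hf.marginal {i, j} (fun t _ => hm t) (by
      simp only [Finset.mem_insert, Finset.mem_singleton]
      rintro t (rfl | rfl) t' (rfl | rfl) h
      · exact absurd rfl h
      · exact hl
      · exact fun h => hl (P.link_symm h)
      · exact absurd rfl h) (Function.update (fun _ => p.2) i p.1)
    rw [Finset.card_pair hij] at this
    simpa [hij.symm] using this
  simp only [h1]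
  rw [Finset.sum_comm]
  have h3 := Finset.sum_le_sum fun p (_ : p ∈ E) => h2 p
  rw [← Finset.sum_mul, Finset.sum_const, nsmul_eq_mul] at h3
  refine le_of_mul_le_mul_right (h3.trans ?_) (by positivity : 0 < (Fintype.card U : ℝ) ^ 2)
  have h4 := mul_le_mul_of_nonneg_right hE
    (by positivity : 0 ≤ C * (Fintype.card U : ℝ) ^ Fintype.card I)
  linarith

/-- Every pattern embeds in every rich graph with suitable parameters. -/
theorem exists_embedding (P : EmbeddingPattern I) :
    ∃ (ε₀ : ℝ) (s₀ : ℕ), 0 < ε₀ ∧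
      ∀ (U : Type*) [Fintype U] [DecidableEq U] [Nonempty U] (G : SimpleGraph U)
        [DecidableRel G.Adj] (ε c : ℝ) (s : ℕ), 0 < ε → ε ≤ ε₀ → s₀ ≤ s → 0 < c → c ≤ 1 →
        IsRich G ε c s → ∃ z : I → U, (∀ i j, P.par i j → G.Adj (z j) (z i)) ∧
          ∀ i j, i ≠ j → ¬ P.link i j → z i ≠ z j ∧ ¬ G.Adj (z i) (z j) := by
  classical
  obtain ⟨m, hm⟩ : ∃ m, ∀ i, P.rank i < m :=
    ⟨Finset.univ.sup P.rank + 1, fun i => Nat.lt_succ_of_le (Finset.le_sup (Finset.mem_univ i))⟩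
  obtain ⟨a, C, K, ε₀, T, s₀, ha, hC, hK, hε₀, h⟩ := P.exists_isPartialDensity m
  let D : Finset (I × I) := Finset.univ.filter fun p => p.1 ≠ p.2 ∧ ¬ P.link p.1 p.2
  refine ⟨min ε₀ (a / (2 * (D.card * C + 1))), s₀, by positivity, ?_⟩
  intro U _ _ _ G _ ε c s hε hεε hs hc hc1 hG
  obtain ⟨f, hf⟩ := h U G ε c s hε (hεε.trans (min_le_left _ _)) hs hc hc1 hG
  by_contra! hno
  have hle : ∀ z, f z ≤ ∑ p ∈ D, if z p.1 = z p.2 ∨ G.Adj (z p.1) (z p.2) then f z else 0 := by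
    intro z
    by_cases hz : f z = 0
    · simp [hz]
    · obtain ⟨i, j, hij, hl, hb⟩ := hno z fun i j hij => hf.adj z hz i j (hm i) hij
      have hb' : z i = z j ∨ G.Adj (z i) (z j) := by tauto
      have hmem : (i, j) ∈ D := by simp [D, hij, hl]
      refine le_trans ?_ (Finset.single_le_sum (fun p _ => ?_) hmem)
      · simp only [hb', if_true, le_refl]
      · split_ifs
        exacts [hf.nonneg z, le_rfl]
  have hsum := Finset.sum_le_sum fun z (_ : z ∈ Finset.univ) => hle z
  rw [Finset.sum_comm] at hsum
  have hsum2 := hsum.trans (Finset.sum_le_sum fun p (hp : p ∈ D) =>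
    hf.sum_conflict_le hC hG hm (Finset.mem_filter.1 hp).2.1 (Finset.mem_filter.1 hp).2.2)
  rw [Finset.sum_const, nsmul_eq_mul, ← mul_assoc] at hsum2
  have hN : 0 < (Fintype.card U : ℝ) ^ Fintype.card I := by
    have hn : (0 : ℝ) < Fintype.card U := by exact_mod_cast Fintype.card_pos
    positivity
  have h1 := le_of_mul_le_mul_right (hf.mass.trans hsum2) hN
  have h2 := hεε.trans (min_le_right _ _)
  rw [le_div_iff₀ (by positivity)] at h2
  nlinarith

end EmbeddingPattern

/-! ### Graphs without sparse pairs are rich -/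

theorem IsSparsePair.symm {U : Type*} {G : SimpleGraph U} {c : ℝ} {A B : Finset U}
    (h : IsSparsePair G c A B) : IsSparsePair G c B A := by
  classical
  refine ⟨h.1.symm, ?_⟩
  have h1 : (G.interedges B A).card = (G.interedges A B).card :=
    haveI : Std.Symm G.Adj := G.symm
    Rel.card_interedges_comm (r := G.Adj) B A
  have h2 : ((G.interedges A B).card : ℝ) ≤ c * A.card * B.card := by
    convert h.2
  have h3 : ((G.interedges B A).card : ℝ) ≤ c * B.card * A.card := by
    rw [h1]; linarith
  convert h3

theorem isSparsePair_of_poor {U : Type*} [DecidableEq U] {G : SimpleGraph U} [DecidableRel G.Adj]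
    {c : ℝ} (hc : 0 ≤ c) {Y A A' : Finset U} (hA : A' ⊆ A) (hdisj : Disjoint Y A')
    (hcard : (A.card : ℝ) ≤ 2 * A'.card)
    (hY : ∀ y ∈ Y, ((A.filter fun x => G.Adj y x).card : ℝ) < c / 2 * A.card) :
    IsSparsePair G c Y A' := by
  refine ⟨hdisj, ?_⟩
  have h : ((G.interedges Y A').card : ℝ) ≤ c * Y.card * A'.card := by
    have h1 : ((G.interedges Y A').card : ℝ) =
        ∑ y ∈ Y, ((A'.filter fun x => G.Adj y x).card : ℝ) := by
      rw [SimpleGraph.interedges, Rel.interedges, ← Finset.sum_boole, Finset.sum_product]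
      simp only [Finset.sum_boole]
    rw [h1]
    calc ∑ y ∈ Y, ((A'.filter fun x => G.Adj y x).card : ℝ) ≤ ∑ y ∈ Y, c * A'.card := by
          refine Finset.sum_le_sum fun y hy => ?_
          have h2 : ((A'.filter fun x => G.Adj y x).card : ℝ) ≤
              (A.filter fun x => G.Adj y x).card := by
            exact_mod_cast Finset.card_le_card (Finset.filter_subset_filter _ hA)
          have h3 := mul_le_mul_of_nonneg_left hcard hc
          linarith [hY y hy]
      _ = c * Y.card * A'.card := by rw [Finset.sum_const, nsmul_eq_mul]; ring
  convert h

theorem cast_card_sdiff_ge {U : Type*} [DecidableEq U] (A B : Finset U) :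
    (A.card : ℝ) - B.card ≤ (A \ B).card := by
  have : (A.card : ℝ) ≤ (A \ B).card + B.card := by
    exact_mod_cast Finset.card_le_card_sdiff_add_card
  linarith

theorem isRich_of_forall_not_isSparsePair {U : Type*} [Fintype U] [DecidableEq U] [Nonempty U]
    {G : SimpleGraph U} [DecidableRel G.Adj] {ε c : ℝ} {s : ℕ} (hε : 0 < ε) (hε8 : ε ≤ 1 / 8)
    (hc : 0 < c) (hc1 : c ≤ 1) (hG : IsBoundedGraph G ε)
    (hno : ∀ A B : Finset U, IsXYPair (ε * c ^ s * Nat.card U) (ε * Nat.card U) A B →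
      ¬ IsSparsePair G c A B) : IsRich G ε c s := by
  simp only [IsBoundedGraph, Nat.card_eq_fintype_card] at hno hG
  set n : ℝ := (Fintype.card U : ℝ)
  have hcs : c ^ s ≤ 1 := pow_le_one₀ hc.le hc1
  have hcs0 : 0 < c ^ s := by positivity
  have hN : ∀ v, (insert v (G.neighborSet v)).ncard =
      (Finset.univ.filter fun y => v = y ∨ G.Adj v y).card := fun v => by
    rw [← Set.ncard_coe_finset]
    congr 1
    ext y
    simp [eq_comm]
  have hεn : 1 ≤ ε * n := by
    let v := Classical.arbitrary U
    refine le_trans ?_ (hG v).le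
    rw [hN]
    exact_mod_cast Finset.card_pos.2 ⟨v, by simp⟩
  have hεcs : ε * c ^ s * n ≤ ε * n := by nlinarith
  have hεcs0 : 0 < ε * c ^ s * n := by
    have : 0 < n := by nlinarith
    positivity
  refine ⟨fun v => by rw [← hN]; exact (hG v).le, fun A hA => ?_, fun B hB => ?_⟩
  · set Y := Finset.univ.filter
      (fun y => ((A.filter fun x => G.Adj y x).card : ℝ) < c / 2 * A.card)
    by_contra! hY
    have hpoor : ∀ Y' ⊆ Y, ∀ y ∈ Y', ((A.filter fun x => G.Adj y x).card : ℝ) < c / 2 * A.card :=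
      fun Y' hY' y hy => (Finset.mem_filter.1 (hY' hy)).2
    rcases le_or_gt (A.card : ℝ) (4 * ε * n) with hsmall | hlarge
    · have h1 := cast_card_sdiff_ge Y A
      refine hno A (Y \ A) ⟨Finset.disjoint_sdiff, by linarith, by linarith⟩
        (isSparsePair_of_poor hc.le subset_rfl Finset.sdiff_disjoint ?_
          (hpoor _ Finset.sdiff_subset)).symm
      linarith [(Nat.cast_nonneg A.card : (0 : ℝ) ≤ A.card)]
    · have hceil : (⌈ε * n⌉₊ : ℝ) < ε * n + 1 := Nat.ceil_lt_add_one (by linarith)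
      obtain ⟨Y', hY', hcard⟩ := Finset.exists_subset_card_eq (s := Y) (n := ⌈ε * n⌉₊)
        (by
          have : (⌈ε * n⌉₊ : ℝ) ≤ Y.card := by linarith
          exact_mod_cast this)
      have hcard' : (Y'.card : ℝ) = ⌈ε * n⌉₊ := by rw [hcard]
      have h1 := cast_card_sdiff_ge A Y'
      have h2 := Nat.le_ceil (ε * n)
      exact hno (A \ Y') Y' ⟨Finset.sdiff_disjoint, by linarith, by linarith⟩
        (isSparsePair_of_poor hc.le Finset.sdiff_subset Finset.disjoint_sdiff (by linarith)
          (hpoor _ hY')).symm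
  · set Y := Finset.univ.filter
      (fun y => ((B.filter fun x => G.Adj y x).card : ℝ) < c / 2 * B.card)
    by_contra! hY
    have hceil : (⌈ε * c ^ s * n⌉₊ : ℝ) < ε * c ^ s * n + 1 := Nat.ceil_lt_add_one hεcs0.le
    obtain ⟨Y', hY', hcard⟩ := Finset.exists_subset_card_eq (s := Y) (n := ⌈ε * c ^ s * n⌉₊)
      (Nat.ceil_le.2 hY.le)
    have hcard' : (Y'.card : ℝ) = ⌈ε * c ^ s * n⌉₊ := by rw [hcard]
    have h1 := cast_card_sdiff_ge B Y'
    have h2 := Nat.le_ceil (ε * c ^ s * n)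
    have h3 : ε * n ≤ n / 8 := by nlinarith
    exact hno Y' (B \ Y') ⟨Finset.disjoint_sdiff, by linarith, by linarith⟩
      (isSparsePair_of_poor hc.le Finset.sdiff_subset Finset.disjoint_sdiff (by linarith)
        fun y hy => (Finset.mem_filter.1 (hY' hy)).2)

/-! ### Ramsey theorems -/

/-- Ramsey's theorem for two colours of the pairs of a finite linearly ordered set. -/
theorem exists_monochromatic_subset (p q : ℕ) : ∃ M : ℕ, ∀ {α : Type} [LinearOrder α]
    (K : Finset α), M ≤ K.card → ∀ r : α → α → Prop, ∃ S ⊆ K,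
      (S.card = p ∧ ∀ u ∈ S, ∀ v ∈ S, u < v → r u v) ∨
      (S.card = q ∧ ∀ u ∈ S, ∀ v ∈ S, u < v → ¬ r u v) := by
  induction p generalizing q with
  | zero => exact ⟨0, fun K _ r => ⟨∅, by simp, Or.inl (by simp)⟩⟩
  | succ p ihp =>
    induction q with
    | zero => exact ⟨0, fun K _ r => ⟨∅, by simp, Or.inr (by simp)⟩⟩
    | succ q ihq =>
      obtain ⟨M₁, h₁⟩ := ihp (q + 1)
      obtain ⟨M₂, h₂⟩ := ihq
      refine ⟨M₁ + M₂ + 1, fun {α} _ K hK r => ?_⟩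
      classical
      have hne : K.Nonempty := Finset.card_pos.1 (by omega)
      set x := K.min' hne
      have hxK : x ∈ K := K.min'_mem hne
      have hlt : ∀ y ∈ K.erase x, x < y := fun y hy => by
        rw [Finset.mem_erase] at hy
        exact lt_of_le_of_ne (K.min'_le y hy.2) (Ne.symm hy.1)
      have hcard : ((K.erase x).filter (r x)).card + ((K.erase x).filter fun y => ¬ r x y).card =
          (K.erase x).card := Finset.card_filter_add_card_filter_not _
      rw [Finset.card_erase_of_mem hxK] at hcard
      have key : ∀ (S : Finset α) (ρ : α → α → Prop), (∀ y ∈ S, y ∈ K.erase x ∧ ρ x y) →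
          (∀ u ∈ S, ∀ v ∈ S, u < v → ρ u v) → insert x S ⊆ K ∧ (insert x S).card = S.card + 1 ∧
          ∀ u ∈ insert x S, ∀ v ∈ insert x S, u < v → ρ u v := by
        intro S ρ hS' hρ
        refine ⟨?_, Finset.card_insert_of_notMem fun h => ?_, ?_⟩
        · exact Finset.insert_subset hxK fun y hy => Finset.mem_of_mem_erase (hS' y hy).1
        · exact lt_irrefl x (hlt x (hS' x h).1)
        · intro u hu v hv huv
          rcases Finset.mem_insert.1 hu with rfl | hu <;> rcases Finset.mem_insert.1 hv with rfl | hv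
          · exact absurd huv (lt_irrefl _)
          · exact (hS' v hv).2
          · exact absurd (hlt u (hS' u hu).1) huv.asymm
          · exact hρ u hu v hv huv
      rcases le_or_gt M₁ ((K.erase x).filter (r x)).card with h | h
      · obtain ⟨S, hS, ⟨hc, hr⟩ | ⟨hc, hr⟩⟩ := h₁ _ h r
        · obtain ⟨h1, h2, h3⟩ := key S r (fun y hy => Finset.mem_filter.1 (hS hy)) hr
          exact ⟨_, h1, Or.inl ⟨by omega, h3⟩⟩
        · exact ⟨S, hS.trans ((Finset.filter_subset _ _).trans (Finset.erase_subset _ _)), Or.inr ⟨hc, hr⟩⟩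
      · obtain ⟨S, hS, ⟨hc, hr⟩ | ⟨hc, hr⟩⟩ := h₂ ((K.erase x).filter fun y => ¬ r x y) (by omega) r
        · exact ⟨S, hS.trans ((Finset.filter_subset _ _).trans (Finset.erase_subset _ _)), Or.inl ⟨hc, hr⟩⟩
        · obtain ⟨h1, h2, h3⟩ := key S (fun u v => ¬ r u v)
            (fun y hy => Finset.mem_filter.1 (hS hy)) hr
          exact ⟨_, h1, Or.inr ⟨by omega, h3⟩⟩

/-- Every finite graph `B` is induced in some finite graph in such a way that, however the vertices
of the latter are coloured with `k` colours, there is a monochromatic induced copy of `B`. The graph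
is an iterated lexicographic product of `B` with itself. -/
theorem exists_vertexRamsey {β : Type} [Finite β] (B : SimpleGraph β) (k : ℕ) :
    ∃ (γ : Type) (_ : Finite γ) (C : SimpleGraph γ), ∀ χ : γ → Fin k,
      ∃ (w : Fin k) (g : B ↪g C), ∀ b, χ (g b) = w := by
  induction k with
  | zero => exact ⟨Unit, inferInstance, ⊥, fun χ => (χ ()).elim0⟩
  | succ k ih =>
    obtain ⟨γ, hγ, C, hC⟩ := ih
    let C' : SimpleGraph (β × γ) :=
      { Adj := fun p q => B.Adj p.1 q.1 ∨ (p.1 = q.1 ∧ C.Adj p.2 q.2)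
        symm := ⟨fun p q h => h.elim (fun h => Or.inl h.symm) fun h => Or.inr ⟨h.1.symm, h.2.symm⟩⟩
        loopless := ⟨fun p h => h.elim (fun h => h.ne rfl) fun h => h.2.ne rfl⟩ }
    refine ⟨β × γ, inferInstance, C', fun χ => ?_⟩
    by_cases h : ∀ b, ∃ x, χ (b, x) = Fin.last k
    · choose x hx using h
      refine ⟨Fin.last k, ⟨⟨fun b => (b, x b), fun b b' h => (Prod.ext_iff.1 h).1⟩, ?_⟩, hx⟩
      intro b b'
      change B.Adj b b' ∨ (b = b' ∧ C.Adj (x b) (x b')) ↔ B.Adj b b'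
      refine or_iff_left ?_
      rintro ⟨rfl, h⟩
      exact h.ne rfl
    · push Not at h
      obtain ⟨b, hb⟩ := h
      obtain ⟨w, g, hg⟩ := hC fun x => (χ (b, x)).castPred (hb x)
      refine ⟨w.castSucc, ⟨⟨fun y => (b, g y), fun y y' h => g.injective (Prod.ext_iff.1 h).2⟩, ?_⟩,
        fun y => ?_⟩
      · intro y y'
        change B.Adj b b ∨ (b = b ∧ C.Adj (g y) (g y')) ↔ B.Adj y y'
        simp
      · have := hg y
        rw [← this, Fin.castSucc_castPred]
        rfl

/-- The graph obtained from `A` by attaching, for each family member `φ`, a copy of `C` all of whose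
vertices have the same neighbourhood `N φ` in `A`. -/
def attachCopies {α γ Φ : Type*} (A : SimpleGraph α) (C : SimpleGraph γ) (N : Φ → Set α) :
    SimpleGraph (α ⊕ Φ × γ) where
  Adj
    | .inl a, .inl a' => A.Adj a a'
    | .inl a, .inr p => a ∈ N p.1
    | .inr p, .inl a => a ∈ N p.1
    | .inr p, .inr p' => p.1 = p'.1 ∧ C.Adj p.2 p'.2
  symm := ⟨by
    rintro (a | p) (a' | p') h
    exacts [h.symm, h, h, ⟨h.1.symm, h.2.symm⟩]⟩
  loopless := ⟨by
    rintro (a | p) h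
    exacts [h.ne rfl, h.2.ne rfl]⟩

/-- For every graph `H` there is a graph `Q` such that, whichever edges of `Q` are coloured red,
there is an induced copy of `H` with all edges red, or a large clique without red edges. For the
induction, copies of a vertex-Ramsey graph are attached to the candidates for a red copy of `H`
minus one vertex: either one of the attached vertices completes a copy of `H`, or many attached
vertices have a non-red edge to the same vertex. -/
theorem exists_inducedRamsey_clique (r : ℕ) (H : SimpleGraph (Fin r)) (m : ℕ) :
    ∃ (κ : Type) (_ : Finite κ) (Q : SimpleGraph κ), ∀ R : κ → κ → Prop, (∀ x y, R x y → R y x) →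
      (∃ f : H ↪g Q, ∀ x y, H.Adj x y → R (f x) (f y)) ∨
      ∃ S : Finset κ, S.card = m ∧ ∀ x ∈ S, ∀ y ∈ S, x ≠ y → Q.Adj x y ∧ ¬ R x y := by
  classical
  induction r generalizing m with
  | zero =>
    refine ⟨Unit, inferInstance, ⊥, fun R _ => Or.inl ⟨⟨⟨Fin.elim0, fun x => x.elim0⟩, ?_⟩, ?_⟩⟩
    · exact fun {x} => x.elim0
    · exact fun x => x.elim0
  | succ r ihr =>
    induction m with
    | zero => exact ⟨Unit, inferInstance, ⊥, fun R _ => Or.inr ⟨∅, by simp⟩⟩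
    | succ m ihm =>
      obtain ⟨α, hα, A, hA⟩ := ihr (H.comap Fin.succ) (m + 1)
      obtain ⟨β, hβ, B, hB⟩ := ihm
      obtain ⟨γ, hγ, C, hC⟩ := exists_vertexRamsey B r
      have hΦ : Finite (H.comap Fin.succ ↪g A) := DFunLike.finite _
      let N : (H.comap Fin.succ ↪g A) → Set α := fun φ => {a | ∃ w, H.Adj 0 (Fin.succ w) ∧ φ w = a}
      refine ⟨_, inferInstance, attachCopies A C N, fun R hR => ?_⟩
      rcases hA (fun a a' => R (.inl a) (.inl a')) (fun a a' => hR _ _) with ⟨φ, hφ⟩ | ⟨S, hS, hSR⟩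
      swap
      · refine Or.inr ⟨S.map .inl, by simpa using hS, ?_⟩
        simp only [Finset.mem_map, Function.Embedding.inl_apply]
        rintro _ ⟨x, hx, rfl⟩ _ ⟨y, hy, rfl⟩ hxy
        exact hSR x hx y hy fun h => hxy (by rw [h])
      by_cases hx : ∃ x, ∀ w, H.Adj 0 (Fin.succ w) → R (.inl (φ w)) (.inr (φ, x))
      · obtain ⟨x, hx⟩ := hx
        have hadj : ∀ w, (attachCopies A C N).Adj (.inl (φ w)) (.inr (φ, x)) ↔
            H.Adj 0 (Fin.succ w) := fun w => by
          constructor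
          · rintro ⟨w', h, hw⟩
            rwa [← φ.injective hw]
          · exact fun h => ⟨w, h, rfl⟩
        refine Or.inl ⟨⟨⟨Fin.cons (.inr (φ, x)) fun w => .inl (φ w), ?_⟩, ?_⟩, ?_⟩
        · rw [Fin.cons_injective_iff]
          exact ⟨by simp, fun w w' h => φ.injective (Sum.inl_injective h)⟩
        · intro u v
          refine Fin.cases ?_ (fun u => ?_) u <;> refine Fin.cases ?_ (fun v => ?_) v
          · simp
          · simpa [SimpleGraph.adj_comm _ (Sum.inr _)] using hadj v
          · simpa [SimpleGraph.adj_comm H _ 0] using hadj u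
          · exact φ.map_rel_iff
        · intro u v
          refine Fin.cases ?_ (fun u => ?_) u <;> refine Fin.cases ?_ (fun v => ?_) v
          · simp
          · exact fun h => hR _ _ (hx v h)
          · exact fun h => hx u h.symm
          · exact fun h => hφ u v h
      · push Not at hx
        choose χ hχ using hx
        obtain ⟨w, g, hg⟩ := hC χ
        rcases hB (fun x y => R (.inr (φ, g x)) (.inr (φ, g y))) (fun x y => hR _ _) with
          ⟨f, hf⟩ | ⟨S, hS, hSR⟩
        · refine Or.inl ⟨⟨⟨fun u => .inr (φ, g (f u)), fun u v h => ?_⟩, ?_⟩, hf⟩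
          · simpa using h
          · intro u v
            change φ = φ ∧ C.Adj (g (f u)) (g (f v)) ↔ _
            simp
        · let e : β ↪ α ⊕ (H.comap Fin.succ ↪g A) × γ :=
            ⟨fun y => .inr (φ, g y), fun y y' h => by simpa using h⟩
          have hw : ∀ y, (attachCopies A C N).Adj (.inl (φ w)) (e y) ∧ ¬ R (.inl (φ w)) (e y) :=
            fun y => by
              have := hχ (g y)
              rw [hg] at this
              exact ⟨⟨w, this.1, rfl⟩, this.2⟩
          refine Or.inr ⟨insert (.inl (φ w)) (S.map e), ?_, ?_⟩
          · rw [Finset.card_insert_of_notMem (by simp [e]), Finset.card_map, hS]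
          · intro x hx y hy hxy
            simp only [Finset.mem_insert, Finset.mem_map] at hx hy
            rcases hx with rfl | ⟨x, hx, rfl⟩ <;> rcases hy with rfl | ⟨y, hy, rfl⟩
            · exact absurd rfl hxy
            · exact hw y
            · exact ⟨(hw x).1.symm, fun h => (hw x).2 (hR _ _ h)⟩
            · have := hSR x hx y hy fun h => hxy (by rw [h])
              exact ⟨⟨rfl, g.map_rel_iff.2 this.1⟩, this.2⟩

/-- The same as `exists_inducedRamsey_clique`, with a linearly ordered vertex set. -/
theorem exists_inducedRamsey_clique_fin {W : Type*} [Finite W] (H : SimpleGraph W) (m : ℕ) :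
    ∃ (N : ℕ) (Q : SimpleGraph (Fin N)), ∀ R : Fin N → Fin N → Prop, (∀ x y, R x y → R y x) →
      (∃ f : H ↪g Q, ∀ x y, H.Adj x y → R (f x) (f y)) ∨
      ∃ S : Finset (Fin N), S.card = m ∧ ∀ x ∈ S, ∀ y ∈ S, x ≠ y → Q.Adj x y ∧ ¬ R x y := by
  obtain ⟨r, ⟨e⟩⟩ := Finite.exists_equiv_fin W
  obtain ⟨κ, hκ, Q, hQ⟩ := exists_inducedRamsey_clique r (H.map e.toEmbedding) m
  obtain ⟨N, ⟨e'⟩⟩ := Finite.exists_equiv_fin κ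
  refine ⟨N, Q.map e'.toEmbedding, fun R hR => ?_⟩
  rcases hQ (fun x y => R (e' x) (e' y)) (fun x y => hR _ _) with ⟨f, hf⟩ | ⟨S, hS, hSR⟩
  · refine Or.inl ⟨((SimpleGraph.Iso.map e H).toEmbedding.trans f).trans
      (SimpleGraph.Iso.map e' Q).toEmbedding, fun x y h => hf _ _ ?_⟩
    exact (SimpleGraph.Iso.map e H).map_rel_iff.2 h
  · refine Or.inr ⟨S.map e'.toEmbedding, by simpa using hS, ?_⟩
    simp only [Finset.mem_map]
    rintro _ ⟨x, hx, rfl⟩ _ ⟨y, hy, rfl⟩ hxy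
    have := hSR x hx y hy fun h => hxy (by rw [h])
    exact ⟨(SimpleGraph.Iso.map e' Q).map_rel_iff.2 this.1, this.2⟩

/-! ### A universal host for subdivisions -/

/-- The vertices of the host graph on `J`: a branch vertex for each element of `J`, and for each
ordered pair of distinct elements the middle of a path of length two, and one of the two inner
vertices of a path of length three. -/
inductive HostVertex (J : Type*)
  | branch (i : J)
  | mid (i j : J) (h : i ≠ j)
  | side (i j : J) (h : i ≠ j)

/-- The host graph on `J`: any two branch vertices are joined by two paths of length two, with
middle vertices `mid i j` and `mid j i`, and by a path of length three, with inner vertices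
`side i j` and `side j i`, where `side i j` is the one next to `branch i`. -/
def hostGraph (J : Type*) : SimpleGraph (HostVertex J) where
  Adj
    | .branch i, .mid a b _ => i = a ∨ i = b
    | .mid a b _, .branch i => i = a ∨ i = b
    | .branch i, .side a _ _ => i = a
    | .side a _ _, .branch i => i = a
    | .side a b _, .side c d _ => a = d ∧ b = c
    | _, _ => False
  symm := ⟨by
    rintro (i | ⟨i, j, h⟩ | ⟨i, j, h⟩) (i' | ⟨i', j', h'⟩ | ⟨i', j', h'⟩) <;> simp +contextual⟩
  loopless := ⟨by
    rintro (i | ⟨i, j, h⟩ | ⟨i, j, h⟩) <;> simp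
    exact fun h' => absurd h' h⟩

theorem hostGraph_cliqueFree (J : Type*) : (hostGraph J).CliqueFree 3 := by
  classical
  intro s hs
  obtain ⟨x, y, z, hxy, hxz, hyz, -⟩ := SimpleGraph.is3Clique_iff.1 hs
  revert hxy hxz hyz
  rcases x with (i | ⟨i, j, h⟩ | ⟨i, j, h⟩) <;> rcases y with (i' | ⟨i', j', h'⟩ | ⟨i', j', h'⟩) <;>
    rcases z with (i'' | ⟨i'', j'', h''⟩ | ⟨i'', j'', h''⟩) <;> simp only [hostGraph] <;> grind

theorem isAlmostBipartite_of_embedding_hostGraph {W J : Type*} {H : SimpleGraph W}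
    (f : H ↪g hostGraph J) : IsAlmostBipartite H := by
  refine ⟨(hostGraph_cliqueFree J).comap ⟨f.toCopy⟩, {x | ∃ i, f x = .branch i}, {x | ∃ i, f x = .branch i}ᶜ,
    disjoint_compl_right, Set.union_compl_self _, ?_, ?_⟩
  · rintro x ⟨i, hx⟩ y ⟨j, hy⟩ - hxy
    rw [← f.map_rel_iff, hx, hy] at hxy
    exact hxy
  · rintro ⟨x, hx⟩
    rw [Set.encard_le_one_iff]
    rintro ⟨y, hy⟩ ⟨z, hz⟩ hxy hxz
    have hxy' : (hostGraph J).Adj (f x) (f y) := f.map_rel_iff.2 hxy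
    have hxz' : (hostGraph J).Adj (f x) (f z) := f.map_rel_iff.2 hxz
    have hx' : ∀ i, f x ≠ .branch i := fun i h => hx ⟨i, h⟩
    have hy' : ∀ i, f y ≠ .branch i := fun i h => hy ⟨i, h⟩
    have hz' : ∀ i, f z ≠ .branch i := fun i h => hz ⟨i, h⟩
    refine Subtype.ext (f.injective ?_)
    revert hx' hy' hz' hxy' hxz'
    rcases f x with (i | ⟨i, j, h⟩ | ⟨i, j, h⟩) <;>
      rcases f y with (i' | ⟨i', j', h'⟩ | ⟨i', j', h'⟩) <;>
      rcases f z with (i'' | ⟨i'', j'', h''⟩ | ⟨i'', j'', h''⟩) <;> simp only [hostGraph] <;> grind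

/-- The map of vertices of host graphs given by an injection of the index sets. -/
def HostVertex.map {J J' : Type*} (e : J ↪ J') : HostVertex J → HostVertex J'
  | .branch i => .branch (e i)
  | .mid i j h => .mid (e i) (e j) (e.injective.ne h)
  | .side i j h => .side (e i) (e j) (e.injective.ne h)

/-- Host graphs are functorial in the index set. -/
def hostGraphMap {J J' : Type*} (e : J ↪ J') : hostGraph J ↪g hostGraph J' where
  toFun := HostVertex.map e
  inj' := by
    rintro (i | ⟨i, j, h⟩ | ⟨i, j, h⟩) (i' | ⟨i', j', h'⟩ | ⟨i', j', h'⟩) <;> simp [HostVertex.map]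
  map_rel_iff' {x y} := by
    change (hostGraph J').Adj (HostVertex.map e x) (HostVertex.map e y) ↔ _
    rcases x with (i | ⟨i, j, h⟩ | ⟨i, j, h⟩) <;> rcases y with (i' | ⟨i', j', h'⟩ | ⟨i', j', h'⟩) <;>
      simp [hostGraph, HostVertex.map]

section
variable {V : Type*} {H' : SimpleGraph V} (o : H'.edgeSet → V × V) (ℓ : H'.edgeSet → ℕ)

/-- The vertex at distance `p` from the first end on the path that replaces the edge `e`, all `p`
beyond the length of the path giving its second end. -/
def pathVertex (e : H'.edgeSet) (p : ℕ) : V ⊕ (Σ e : H'.edgeSet, Fin (ℓ e)) :=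
  if p = 0 then .inl (o e).1 else
    if h : p - 1 < ℓ e then .inr ⟨e, p - 1, h⟩ else .inl (o e).2

theorem pathVertex_eq_inl {e : H'.edgeSet} {p : ℕ} {u : V} :
    pathVertex o ℓ e p = .inl u ↔ (p = 0 ∧ u = (o e).1) ∨ (ℓ e < p ∧ u = (o e).2) := by
  unfold pathVertex
  split_ifs <;> grind

theorem pathVertex_eq_inr {e e' : H'.edgeSet} {p : ℕ} {a : Fin (ℓ e')} :
    pathVertex o ℓ e p = .inr ⟨e', a⟩ ↔ e' = e ∧ p = a + 1 := by
  unfold pathVertex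
  split_ifs with h h'
  · simp; omega
  · simp only [Sum.inr.injEq, Sigma.mk.injEq]
    constructor
    · rintro ⟨rfl, h1⟩
      have := congrArg Fin.val (eq_of_heq h1)
      exact ⟨rfl, by simp at this; omega⟩
    · rintro ⟨rfl, h1⟩
      exact ⟨rfl, heq_of_eq (Fin.ext (by simp [h1]))⟩
  · simp only [false_iff, not_and]
    rintro rfl h1
    have := a.2
    omega

theorem inl_eq_pathVertex {e : H'.edgeSet} {p : ℕ} {u : V} :
    .inl u = pathVertex o ℓ e p ↔ (p = 0 ∧ u = (o e).1) ∨ (ℓ e < p ∧ u = (o e).2) := by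
  rw [eq_comm, pathVertex_eq_inl]

theorem inr_eq_pathVertex {e e' : H'.edgeSet} {p : ℕ} {a : Fin (ℓ e')} :
    .inr ⟨e', a⟩ = pathVertex o ℓ e p ↔ e' = e ∧ p = a + 1 := by
  rw [eq_comm, pathVertex_eq_inr]

theorem pathVertex_eq_pathVertex {e e' : H'.edgeSet} {p p' : ℕ}
    (h : pathVertex o ℓ e p = pathVertex o ℓ e' p') :
    (e = e' ∧ p = p') ∨ ((p = 0 ∨ ℓ e < p) ∧ (p' = 0 ∨ ℓ e' < p') ∧
      (if p = 0 then (o e).1 else (o e).2) = if p' = 0 then (o e').1 else (o e').2) := by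
  rcases hx : pathVertex o ℓ e' p' with u | ⟨e'', a⟩ <;> rw [hx] at h
  · rw [pathVertex_eq_inl] at h hx
    grind
  · rw [pathVertex_eq_inr] at h hx
    exact Or.inl ⟨h.1.symm.trans hx.1, h.2.trans hx.2.symm⟩

theorem pathVertex_ne_add_two (ho : ∀ e, (o e).1 ≠ (o e).2) {e : H'.edgeSet} {p : ℕ}
    (hp : p < ℓ e) : pathVertex o ℓ e p ≠ pathVertex o ℓ e (p + 2) := by
  intro h
  rcases hx : pathVertex o ℓ e p with u | ⟨e', a⟩ <;> rw [hx] at h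
  · have h1 := (pathVertex_eq_inl o ℓ).1 hx
    have h2 := (pathVertex_eq_inl o ℓ).1 h.symm
    have := ho e
    grind
  · have h1 := (pathVertex_eq_inr o ℓ).1 hx
    have h2 := (pathVertex_eq_inr o ℓ).1 h.symm
    omega

theorem pathVertex_ne_snd (ho : ∀ e, (o e).1 ≠ (o e).2) {e : H'.edgeSet} {p : ℕ}
    (hp : p ≤ ℓ e) : pathVertex o ℓ e p ≠ .inl (o e).2 := by
  intro h
  have := (pathVertex_eq_inl o ℓ).1 h
  have := ho e
  grind

/-- A path of length `ℓ e + 1` is cut into pieces of length two and, if its length is odd, a last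
piece of length three. -/
def subdivisionToHost (ho : ∀ e, (o e).1 ≠ (o e).2) :
    V ⊕ (Σ e : H'.edgeSet, Fin (ℓ e)) → HostVertex (V ⊕ (Σ e : H'.edgeSet, Fin (ℓ e)))
  | .inl v => .branch (.inl v)
  | .inr ⟨e, a⟩ =>
    if (a : ℕ) % 2 = 1 then
      if (a : ℕ) + 1 = ℓ e then .side (.inl (o e).2) (pathVertex o ℓ e (a - 1))
        (pathVertex_ne_snd o ℓ ho (by omega)).symm
      else .branch (.inr ⟨e, a⟩)
    else
      if (a : ℕ) + 2 = ℓ e then .side (pathVertex o ℓ e a) (.inl (o e).2)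
        (pathVertex_ne_snd o ℓ ho a.2.le)
      else .mid (pathVertex o ℓ e a) (pathVertex o ℓ e (a + 2)) (pathVertex_ne_add_two o ℓ ho a.2)

/-- The four kinds of inner vertices of the paths, and where they go. -/
theorem subdivisionToHost_inr (ho : ∀ e, (o e).1 ≠ (o e).2) (e : H'.edgeSet) (a : Fin (ℓ e)) :
    ((a : ℕ) % 2 = 1 ∧ (a : ℕ) + 1 < ℓ e ∧
      subdivisionToHost o ℓ ho (.inr ⟨e, a⟩) = .branch (.inr ⟨e, a⟩)) ∨
    ((a : ℕ) % 2 = 1 ∧ (a : ℕ) + 1 = ℓ e ∧ ∃ h, subdivisionToHost o ℓ ho (.inr ⟨e, a⟩) =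
      .side (.inl (o e).2) (pathVertex o ℓ e (a - 1)) h) ∨
    ((a : ℕ) % 2 = 0 ∧ (a : ℕ) + 2 = ℓ e ∧ ∃ h, subdivisionToHost o ℓ ho (.inr ⟨e, a⟩) =
      .side (pathVertex o ℓ e a) (.inl (o e).2) h) ∨
    ((a : ℕ) % 2 = 0 ∧ (a : ℕ) < ℓ e ∧ (a : ℕ) + 2 ≠ ℓ e ∧ ∃ h,
      subdivisionToHost o ℓ ho (.inr ⟨e, a⟩) =
        .mid (pathVertex o ℓ e a) (pathVertex o ℓ e (a + 2)) h) := by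
  have ha := a.2
  by_cases h1 : (a : ℕ) % 2 = 1
  · by_cases h2 : (a : ℕ) + 1 = ℓ e
    · refine Or.inr (Or.inl ⟨h1, h2, ?_⟩)
      simp [subdivisionToHost, h1, h2, Ne.symm (pathVertex_ne_snd o ℓ ho (e := e) (p := a - 1) (by omega))]
    · refine Or.inl ⟨h1, by omega, ?_⟩
      simp [subdivisionToHost, h1, h2]
  · by_cases h2 : (a : ℕ) + 2 = ℓ e
    · refine Or.inr (Or.inr (Or.inl ⟨by omega, h2, ?_⟩))
      simp [subdivisionToHost, h1, h2, pathVertex_ne_snd o ℓ ho (e := e) (p := a) (by omega)]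
    · refine Or.inr (Or.inr (Or.inr ⟨by omega, ha, h2, ?_⟩))
      simp [subdivisionToHost, h1, h2, pathVertex_ne_add_two o ℓ ho ha]

/-- The ends determine the edge. -/
theorem edge_ext (hoe : ∀ e, s((o e).1, (o e).2) = (e : Sym2 V)) {e e' : H'.edgeSet}
    (h : (o e).1 = (o e').1 ∧ (o e).2 = (o e').2 ∨ (o e).1 = (o e').2 ∧ (o e).2 = (o e').1) :
    e = e' := by
  refine Subtype.ext ?_
  rw [← hoe e, ← hoe e', Sym2.eq_iff]
  exact h

theorem subdivisionToHost_injective (hoe : ∀ e, s((o e).1, (o e).2) = (e : Sym2 V))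
    (ho : ∀ e, (o e).1 ≠ (o e).2) : Function.Injective (subdivisionToHost o ℓ ho) := by
  have hinl : ∀ v, subdivisionToHost o ℓ ho (.inl v) = .branch (.inl v) := fun _ => rfl
  have hext : ∀ {e e' : H'.edgeSet} {a : Fin (ℓ e)} {a' : Fin (ℓ e')}, e = e' ∧ (a : ℕ) = a' →
      (.inr ⟨e, a⟩ : V ⊕ (Σ e : H'.edgeSet, Fin (ℓ e))) = .inr ⟨e', a'⟩ := by
    rintro e _ a a' ⟨rfl, h⟩
    rw [Fin.ext h]
  rintro (v | ⟨e, a⟩) (v' | ⟨e', a'⟩) hxy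
  · simpa [hinl] using hxy
  · rw [hinl] at hxy
    rcases subdivisionToHost_inr o ℓ ho e' a' with
      ⟨_, _, h⟩ | ⟨_, _, _, h⟩ | ⟨_, _, _, h⟩ | ⟨_, _, _, _, h⟩ <;> simp [h] at hxy
  · rw [hinl] at hxy
    rcases subdivisionToHost_inr o ℓ ho e a with
      ⟨_, _, h⟩ | ⟨_, _, _, h⟩ | ⟨_, _, _, h⟩ | ⟨_, _, _, _, h⟩ <;> simp [h] at hxy
  · have hE := edge_ext o hoe (e := e) (e' := e')
    have hoe := ho e
    rcases subdivisionToHost_inr o ℓ ho e a with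
      ⟨ha, ha', h⟩ | ⟨ha, ha', _, h⟩ | ⟨ha, ha', _, h⟩ | ⟨ha, ha', ha'', _, h⟩ <;>
    rcases subdivisionToHost_inr o ℓ ho e' a' with
      ⟨hb, hb', h'⟩ | ⟨hb, hb', _, h'⟩ | ⟨hb, hb', _, h'⟩ | ⟨hb, hb', hb'', _, h'⟩ <;>
    rw [h, h'] at hxy
    all_goals try (simp only [reduceCtorEq] at hxy)
    · exact HostVertex.branch.inj hxy
    · obtain ⟨h1, h2⟩ := HostVertex.side.inj hxy
      have h1 := Sum.inl_injective h1
      have h2 := pathVertex_eq_pathVertex o ℓ h2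
      refine hext ?_
      grind
    · obtain ⟨h1, h2⟩ := HostVertex.side.inj hxy
      have h1 := (pathVertex_eq_inl o ℓ).1 h1.symm
      have h2 := (pathVertex_eq_inl o ℓ).1 h2
      grind
    · obtain ⟨h1, h2⟩ := HostVertex.side.inj hxy
      have h1 := (pathVertex_eq_inl o ℓ).1 h1
      have h2 := (pathVertex_eq_inl o ℓ).1 h2.symm
      grind
    · obtain ⟨h1, h2⟩ := HostVertex.side.inj hxy
      have h1 := pathVertex_eq_pathVertex o ℓ h1
      have h2 := Sum.inl_injective h2
      refine hext ?_
      grind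
    · obtain ⟨h1, h2⟩ := HostVertex.mid.inj hxy
      have h1 := pathVertex_eq_pathVertex o ℓ h1
      have h2 := pathVertex_eq_pathVertex o ℓ h2
      refine hext ?_
      grind

theorem subdivide_adj_inl_inl (hℓ : ∀ e, 1 ≤ ℓ e) (u v : V) :
    ¬ (subdivide H' o ℓ).Adj (.inl u) (.inl v) := by
  rintro ⟨-, ⟨e, he, -⟩ | ⟨e, he, -⟩⟩ <;>
  · have := hℓ e
    omega

theorem subdivide_adj_inl_inr (u : V) (e : H'.edgeSet) (a : Fin (ℓ e)) :
    (subdivide H' o ℓ).Adj (.inl u) (.inr ⟨e, a⟩) ↔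
      ((o e).1 = u ∧ (a : ℕ) = 0) ∨ ((o e).2 = u ∧ (a : ℕ) + 1 = ℓ e) := by
  simp [subdivide, SubdivStep]

theorem subdivide_adj_inr_inr (e e' : H'.edgeSet) (a : Fin (ℓ e)) (a' : Fin (ℓ e')) :
    (subdivide H' o ℓ).Adj (.inr ⟨e, a⟩) (.inr ⟨e', a'⟩) ↔
      e = e' ∧ ((a : ℕ) + 1 = a' ∨ (a' : ℕ) + 1 = a) := by
  simp only [subdivide, SimpleGraph.fromRel_adj, SubdivStep]
  constructor
  · rintro ⟨-, ⟨rfl, h⟩ | ⟨rfl, h⟩⟩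
    exacts [⟨rfl, Or.inl h⟩, ⟨rfl, Or.inr h⟩]
  · rintro ⟨rfl, h⟩
    refine ⟨fun hne => ?_, h.imp (fun h => ⟨rfl, h⟩) fun h => ⟨rfl, h⟩⟩
    obtain rfl : a = a' := by simpa using hne
    omega

theorem hostGraph_adj_inl_inr (ho : ∀ e, (o e).1 ≠ (o e).2) (u : V) (e : H'.edgeSet)
    (a : Fin (ℓ e)) :
    (hostGraph _).Adj (subdivisionToHost o ℓ ho (.inl u)) (subdivisionToHost o ℓ ho (.inr ⟨e, a⟩)) ↔
      (subdivide H' o ℓ).Adj (.inl u) (.inr ⟨e, a⟩) := by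
  have hu : subdivisionToHost o ℓ ho (.inl u) = .branch (.inl u) := rfl
  rw [subdivide_adj_inl_inr, hu]
  rcases subdivisionToHost_inr o ℓ ho e a with
      ⟨ha, ha', h⟩ | ⟨ha, ha', _, h⟩ | ⟨ha, ha', _, h⟩ | ⟨ha, ha', ha'', _, h⟩ <;> rw [h]
  · simp only [hostGraph, false_iff]
    omega
  · simp only [hostGraph, Sum.inl.injEq]
    grind
  · simp only [hostGraph, inl_eq_pathVertex]
    grind
  · simp only [hostGraph, inl_eq_pathVertex]
    grind

theorem hostGraph_adj_inr_inr (hoe : ∀ e, s((o e).1, (o e).2) = (e : Sym2 V))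
    (ho : ∀ e, (o e).1 ≠ (o e).2) (e e' : H'.edgeSet) (a : Fin (ℓ e)) (a' : Fin (ℓ e')) :
    (hostGraph _).Adj (subdivisionToHost o ℓ ho (.inr ⟨e, a⟩))
        (subdivisionToHost o ℓ ho (.inr ⟨e', a'⟩)) ↔
      (subdivide H' o ℓ).Adj (.inr ⟨e, a⟩) (.inr ⟨e', a'⟩) := by
  rw [subdivide_adj_inr_inr]
  have hE := edge_ext o hoe (e := e) (e' := e')
  have hoe := ho e
  have hoe' := ho e'
  have hb := a.2
  have hb' := a'.2
  rcases subdivisionToHost_inr o ℓ ho e a with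
      ⟨ha, ha', h⟩ | ⟨ha, ha', _, h⟩ | ⟨ha, ha', _, h⟩ | ⟨ha, ha', ha'', _, h⟩ <;>
    rcases subdivisionToHost_inr o ℓ ho e' a' with
      ⟨hb, hb', h'⟩ | ⟨hb, hb', _, h'⟩ | ⟨hb, hb', _, h'⟩ | ⟨hb, hb', hb'', _, h'⟩ <;>
    rw [h, h'] <;> simp only [hostGraph, false_iff, reduceCtorEq,
      inr_eq_pathVertex, inl_eq_pathVertex, pathVertex_eq_inl]
  all_goals try grind
  · constructor
    · rintro ⟨h1, h2⟩
      have h1 := Sum.inl_injective h1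
      have h2 := pathVertex_eq_pathVertex o ℓ h2
      grind
    · rintro ⟨rfl, h3⟩
      exact ⟨rfl, by rw [show (a : ℕ) - 1 = a' by omega]⟩
  · constructor
    · rintro ⟨h1, h2⟩
      have h1 := pathVertex_eq_pathVertex o ℓ h1
      have h2 := Sum.inl_injective h2
      grind
    · rintro ⟨rfl, h3⟩
      exact ⟨by rw [show (a : ℕ) = a' - 1 by omega], rfl⟩

/-- Subdivisions are induced subgraphs of host graphs. -/
theorem exists_embedding_hostGraph {W : Type*} {H : SimpleGraph W} (hH : IsGeOneSubdivision H H') :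
    ∃ ℓ : H'.edgeSet → ℕ, Nonempty (H ↪g hostGraph (V ⊕ (Σ e : H'.edgeSet, Fin (ℓ e)))) := by
  obtain ⟨o, ℓ, hoe, hℓ, ⟨φ⟩⟩ := hH
  have ho : ∀ e, (o e).1 ≠ (o e).2 := fun e => by
    have he : s((o e).1, (o e).2) ∈ H'.edgeSet := (hoe e).symm ▸ e.2
    exact (SimpleGraph.mem_edgeSet H' |>.1 he).ne
  refine ⟨ℓ, ⟨φ.toEmbedding.trans
    ⟨⟨subdivisionToHost o ℓ ho, subdivisionToHost_injective o ℓ hoe ho⟩, ?_⟩⟩⟩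
  rintro (u | ⟨e, a⟩) (v | ⟨e', a'⟩)
  · exact iff_of_false id (subdivide_adj_inl_inl o ℓ hℓ u v)
  · exact hostGraph_adj_inl_inr o ℓ ho u e' a'
  · rw [SimpleGraph.adj_comm, SimpleGraph.adj_comm _ (Sum.inr _)]
    exact hostGraph_adj_inl_inr o ℓ ho v e a
  · exact hostGraph_adj_inr_inr o ℓ hoe ho e e' a a'

end

/-! ### The pattern -/

/-- An increasing triple. -/
structure IncTriple (N : ℕ) where
  /-- the smallest entry -/
  fst : Fin N
  /-- the middle entry -/
  snd : Fin N
  /-- the largest entry -/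
  thd : Fin N
  fst_lt : fst < snd
  snd_lt : snd < thd

/-- The vertices of the pattern attached to a graph on `Fin N`. The vertices `main v` contain the
candidates for branch vertices; `priv v` is a private neighbour of `main v`, and `conn v w` is a
common neighbour of `main v` and `main w`; the path `lo t`, `mi t`, `hi t` sees the main vertices of
the three entries of `t`, in this order. -/
inductive PatternVertex (N : ℕ)
  | priv (v : Fin N)
  | conn (v w : Fin N)
  | main (v : Fin N)
  | lo (t : IncTriple N)
  | mi (t : IncTriple N)
  | hi (t : IncTriple N)

namespace PatternVertex

variable {N : ℕ} (Q : SimpleGraph (Fin N))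

instance : Finite (IncTriple N) :=
  Finite.of_injective (fun t : IncTriple N => (t.fst, t.snd, t.thd)) (by
    rintro ⟨a, b, c, h, h'⟩ ⟨a', b', c', k, k'⟩ h
    simpa using h)

instance : Finite (PatternVertex N) :=
  Finite.of_injective (β := Fin N ⊕ (Fin N × Fin N) ⊕ Fin N ⊕ IncTriple N ⊕ IncTriple N ⊕
      IncTriple N)
    (fun
      | priv v => .inl v
      | conn v w => .inr (.inl (v, w))
      | main v => .inr (.inr (.inl v))
      | lo t => .inr (.inr (.inr (.inl t)))
      | mi t => .inr (.inr (.inr (.inr (.inl t))))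
      | hi t => .inr (.inr (.inr (.inr (.inr t))))) (by
    rintro (_ | _ | _ | _ | _ | _) (_ | _ | _ | _ | _ | _) <;> simp)

/-- The parent relation of the pattern. -/
def par : PatternVertex N → PatternVertex N → Prop
  | main v, priv w => v = w
  | main v, conn a b => (v = a ∨ v = b) ∧ Q.Adj a b
  | main v, lo t => v = t.fst
  | main v, mi t => v = t.snd
  | main v, hi t => v = t.thd
  | mi t, lo t' => t = t'
  | hi t, mi t' => t = t'
  | _, _ => False

/-- The links of the pattern other than those between parents and children. -/
def extraLink : PatternVertex N → PatternVertex N → Prop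
  | main v, main w => Q.Adj v w
  | main v, lo t => v = t.snd
  | main v, mi t => v = t.thd
  | _, _ => False

/-- The link relation of the pattern. -/
def link (x y : PatternVertex N) : Prop :=
  par Q x y ∨ par Q y x ∨ extraLink Q x y ∨ extraLink Q y x

/-- The vertices with a single parent whose parent is on the same path. -/
def strong : PatternVertex N → Prop
  | mi _ => True
  | hi _ => True
  | _ => False

/-- A vertex of one of the paths is placed after the main vertex seen by its predecessor, and before
the main vertex it sees itself. -/
def time : PatternVertex N → ℕ
  | main v => 3 * v + 1
  | mi t => 3 * t.fst + 2
  | hi t => 3 * t.snd + 2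
  | _ => 0

theorem time_lt_of_par {x y : PatternVertex N} (h : par Q x y) : time y < time x := by
  have h1 : ∀ t : IncTriple N, (t.fst : ℕ) < t.snd := fun t => t.fst_lt
  have h2 : ∀ t : IncTriple N, (t.snd : ℕ) < t.thd := fun t => t.snd_lt
  cases x <;> cases y <;> simp only [par] at h <;> simp only [time] <;> grind

theorem not_link_of_par_of_par {i j j' : PatternVertex N} (hi : ¬ strong i) (h : par Q i j)
    (h' : par Q i j') : ¬ link Q j j' := by
  have h1 : ∀ t : IncTriple N, t.fst ≠ t.snd := fun t => t.fst_lt.ne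
  have h2 : ∀ t : IncTriple N, t.snd ≠ t.thd := fun t => t.snd_lt.ne
  cases i <;> simp only [par, strong, not_true_eq_false] at h hi
  all_goals cases j <;> simp only at h
  all_goals cases j' <;> simp only [par] at h' <;> simp only [link, par, extraLink] <;> grind

theorem link_of_par_of_link {i j s : PatternVertex N} (hi : ¬ strong i) (h : par Q i j)
    (hs : time s ≤ time i) (hsi : s ≠ i) (h' : link Q j s) : link Q i s := by
  have h1 : ∀ t : IncTriple N, (t.fst : ℕ) < t.snd := fun t => t.fst_lt
  have h2 : ∀ t : IncTriple N, (t.snd : ℕ) < t.thd := fun t => t.snd_lt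
  have hQ : ∀ v w, Q.Adj v w → Q.Adj w v := fun v w h => h.symm
  cases i <;> simp only [par, strong, not_true_eq_false] at h hi
  all_goals cases j <;> simp only at h
  all_goals cases s <;>
    simp only [link, par, extraLink, time, main.injEq, ne_eq, or_false, false_or] at h' hs hsi ⊢ <;>
    grind

/-- The pattern attached to a graph on `Fin N`, ordered by `time`, ties being broken arbitrarily. -/
theorem exists_pattern : ∃ P : EmbeddingPattern (PatternVertex N), P.par = par Q ∧ P.link = link Q := by
  obtain ⟨M, ⟨e⟩⟩ := Finite.exists_equiv_fin (PatternVertex N)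
  have hlt : ∀ {x y : PatternVertex N}, time x < time y → time x * M + e x < time y * M + e y := by
    intro x y h
    have h1 : (time x + 1) * M ≤ time y * M := Nat.mul_le_mul_right M h
    have h2 := (e x).2
    rw [add_mul] at h1
    omega
  exact ⟨{
    rank := fun x => time x * M + e x
    rank_injective := fun x y h => by
      rcases lt_trichotomy (time x) (time y) with h' | h' | h'
      · exact absurd h (hlt h').ne
      · simp only [h', Nat.add_left_cancel_iff] at h
        exact e.injective (Fin.ext h)
      · exact absurd h (hlt h').ne'
    par := par Q
    rank_lt_of_par := fun h => hlt (time_lt_of_par Q h)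
    strong := strong
    exists_parent_of_strong := fun {i} hi => by
      rcases i with v | ⟨v, w⟩ | v | t | t | t
      · exact hi.elim
      · exact hi.elim
      · exact hi.elim
      · exact hi.elim
      · refine ⟨lo t, fun j => ?_⟩
        cases j <;> simp [par, eq_comm]
      · refine ⟨mi t, fun j => ?_⟩
        cases j <;> simp [par, eq_comm]
    link := link Q
    link_symm := fun h => by
      unfold link at h ⊢
      tauto
    link_of_par := fun h => Or.inl h
    not_link_of_par_of_par := fun hi h h' _ => not_link_of_par_of_par Q hi h h'
    link_of_par_of_link := fun {i j s} hi h hr _ h' =>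
      link_of_par_of_link Q hi h (not_lt.1 fun h'' => (hlt h'').not_gt hr)
        (by rintro rfl; exact lt_irrefl _ hr) h' }, rfl, rfl⟩

end PatternVertex

/-! ### Finding the host graph in an embedded pattern -/

namespace PatternVertex

/-- A map of the pattern to `G` that respects the pattern: children are adjacent to their parents,
and unlinked vertices are mapped to distinct nonadjacent vertices. -/
structure IsRealization {N : ℕ} (Q : SimpleGraph (Fin N)) {U : Type*} (G : SimpleGraph U)
    (z : PatternVertex N → U) : Prop where
  adj : ∀ i j, par Q i j → G.Adj (z j) (z i)
  ne_and_not_adj : ∀ i j, i ≠ j → ¬ link Q i j → z i ≠ z j ∧ ¬ G.Adj (z i) (z j)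

variable {N : ℕ} {Q : SimpleGraph (Fin N)} {U : Type*} {G : SimpleGraph U}
  {z : PatternVertex N → U}

theorem IsRealization.not_adj (hz : IsRealization Q G z) {i j : PatternVertex N}
    (h : ¬ link Q i j) : ¬ G.Adj (z i) (z j) := by
  by_cases hij : i = j
  · subst hij
    exact G.irrefl
  · exact (hz.ne_and_not_adj i j hij h).2

/-- Private neighbours tell the main vertices from all other vertices. -/
theorem IsRealization.main_ne (hz : IsRealization Q G z) (v : Fin N) {x : PatternVertex N}
    (hx : main v ≠ x) : z (main v) ≠ z x := by
  intro h
  have h1 : G.Adj (z (priv v)) (z (main v)) := hz.adj _ _ rfl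
  rw [h] at h1
  refine hz.not_adj ?_ h1
  cases x <;> simp [link, par, extraLink]
  simpa [eq_comm] using hx

theorem IsRealization.injective (hz : IsRealization Q G z) : Function.Injective z := by
  intro x y hxy
  by_contra hne
  by_cases hl : link Q x y
  · have hpar : ∀ x y, par Q x y → z x ≠ z y := fun x y h => (hz.adj x y h).ne'
    have hextra : ∀ x y, x ≠ y → extraLink Q x y → z x ≠ z y := by
      intro x y hne h
      cases x <;> simp only [extraLink] at h
      exact hz.main_ne _ hne
    rcases hl with h | h | h | h
    · exact hpar _ _ h hxy
    · exact hpar _ _ h hxy.symm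
    · exact hextra _ _ hne h hxy
    · exact hextra _ _ (Ne.symm hne) h hxy.symm
  · exact (hz.ne_and_not_adj x y hne hl).1 hxy

/-- Where the paths of length three come from: for each pair of branch vertices there is a path with
two consecutive inner vertices `x t` and `y t`. -/
theorem IsRealization.exists_embedding_hostGraph (hz : IsRealization Q G z) {k : ℕ}
    {β : Fin k → Fin N} (hβ : Function.Injective β) (hQ : ∀ i j, i ≠ j → Q.Adj (β i) (β j))
    (hmain : ∀ i j, ¬ G.Adj (z (main (β i))) (z (main (β j))))
    (T : ∀ i j : Fin k, i < j → IncTriple N)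
    (hT : ∀ i j h i' j' h', T i j h = T i' j' h' → i = i' ∧ j = j')
    {x y : IncTriple N → PatternVertex N} (hxy : x = mi ∧ y = hi ∨ x = lo ∧ y = mi)
    (hx : ∀ i j h l, G.Adj (z (main (β l))) (z (x (T i j h))) ↔ l = i)
    (hy : ∀ i j h l, G.Adj (z (main (β l))) (z (y (T i j h))) ↔ l = j) :
    Nonempty (hostGraph (Fin k) ↪g G) := by
  let S : ∀ i j : Fin k, i ≠ j → PatternVertex N := fun i j h =>
    if hij : i < j then x (T i j hij) else y (T j i (lt_of_le_of_ne (not_lt.1 hij) h.symm))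
  let F : HostVertex (Fin k) → PatternVertex N
    | .branch i => main (β i)
    | .mid i j _ => conn (β i) (β j)
    | .side i j h => S i j h
  have hS : ∀ i j h, (∃ hij : i < j, S i j h = x (T i j hij)) ∨
      ∃ hji : j < i, S i j h = y (T j i hji) := by
    intro i j h
    rcases h.lt_or_gt with h' | h'
    · exact Or.inl ⟨h', dif_pos h'⟩
    · exact Or.inr ⟨h', dif_neg h'.asymm⟩
  have hmid : ∀ i j (_ : i ≠ j) l, G.Adj (z (main (β l))) (z (conn (β i) (β j))) ↔ l = i ∨ l = j := by
    intro i j h l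
    by_cases hl : l = i ∨ l = j
    · simp only [hl, iff_true]
      exact (hz.adj (main _) (conn _ _) ⟨hl.imp (congrArg β) (congrArg β), hQ i j h⟩).symm
    · simp only [hl, iff_false]
      refine hz.not_adj ?_
      simp [link, par, extraLink, hβ.eq_iff, hl]
  have hside : ∀ i j h l, G.Adj (z (main (β l))) (z (S i j h)) ↔ l = i := by
    intro i j h l
    rcases hS i j h with ⟨h', h''⟩ | ⟨h', h''⟩ <;> rw [h'']
    exacts [hx _ _ _ _, hy _ _ _ _]
  have hcs : ∀ a b i j h, ¬ G.Adj (z (conn a b)) (z (S i j h)) := by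
    intro a b i j h
    refine hz.not_adj ?_
    rcases hxy with ⟨rfl, rfl⟩ | ⟨rfl, rfl⟩ <;> rcases hS i j h with ⟨h', h''⟩ | ⟨h', h''⟩ <;>
      simp [h'', link, par, extraLink]
  have hxx : ∀ t t', ¬ G.Adj (z (x t)) (z (x t')) := fun t t' => hz.not_adj (by
    rcases hxy with ⟨rfl, rfl⟩ | ⟨rfl, rfl⟩ <;> simp [link, par, extraLink])
  have hyy : ∀ t t', ¬ G.Adj (z (y t)) (z (y t')) := fun t t' => hz.not_adj (by
    rcases hxy with ⟨rfl, rfl⟩ | ⟨rfl, rfl⟩ <;> simp [link, par, extraLink])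
  have hadj : ∀ t t', G.Adj (z (x t)) (z (y t')) ↔ t = t' := by
    intro t t'
    constructor
    · intro h
      by_contra hne
      refine hz.not_adj ?_ h
      rcases hxy with ⟨rfl, rfl⟩ | ⟨rfl, rfl⟩ <;> simp [link, par, extraLink, Ne.symm hne]
    · rintro rfl
      rcases hxy with ⟨rfl, rfl⟩ | ⟨rfl, rfl⟩ <;> exact hz.adj _ _ rfl
  have hss : ∀ i j h i' j' h', G.Adj (z (S i j h)) (z (S i' j' h')) ↔ i = j' ∧ j = i' := by
    intro i j h i' j' h'
    rcases hS i j h with ⟨hl, e⟩ | ⟨hl, e⟩ <;> rcases hS i' j' h' with ⟨hl', e'⟩ | ⟨hl', e'⟩ <;>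
      rw [e, e']
    · exact iff_of_false (hxx _ _) (by omega)
    · rw [hadj]
      constructor
      · exact hT _ _ _ _ _ _
      · rintro ⟨rfl, rfl⟩
        rfl
    · rw [SimpleGraph.adj_comm, hadj]
      constructor
      · exact fun h => (hT _ _ _ _ _ _ h).symm.imp Eq.symm Eq.symm
      · rintro ⟨rfl, rfl⟩
        rfl
    · exact iff_of_false (hyy _ _) (by omega)
  have hSinj : ∀ i j h i' j' h', S i j h = S i' j' h' → i = i' ∧ j = j' := by
    intro i j h i' j' h' he
    have h1 : i = i' := (hside i' j' h' i).1 (he ▸ (hside i j h i).2 rfl)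
    have h2 : i' = i ∧ j' = j :=
      (hss i' j' h' j i h.symm).1 (he ▸ (hss i j h j i h.symm).2 ⟨rfl, rfl⟩)
    exact ⟨h1, h2.2.symm⟩
  have hSne : ∀ i j h w, (∀ t, x t ≠ w) → (∀ t, y t ≠ w) → S i j h ≠ w := by
    intro i j h w h1 h2
    rcases hS i j h with ⟨hl, e⟩ | ⟨hl, e⟩ <;> rw [e]
    exacts [h1 _, h2 _]
  have hSmain : ∀ i j h v, S i j h ≠ main v := fun i j h v => hSne i j h _
    (by rcases hxy with ⟨rfl, rfl⟩ | ⟨rfl, rfl⟩ <;> simp)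
    (by rcases hxy with ⟨rfl, rfl⟩ | ⟨rfl, rfl⟩ <;> simp)
  have hSconn : ∀ i j h v w, S i j h ≠ conn v w := fun i j h v w => hSne i j h _
    (by rcases hxy with ⟨rfl, rfl⟩ | ⟨rfl, rfl⟩ <;> simp)
    (by rcases hxy with ⟨rfl, rfl⟩ | ⟨rfl, rfl⟩ <;> simp)
  have hF : Function.Injective F := by
    rintro (i | ⟨i, j, h⟩ | ⟨i, j, h⟩) (i' | ⟨i', j', h'⟩ | ⟨i', j', h'⟩) he
    · simpa [F, hβ.eq_iff] using he
    · simp [F] at he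
    · exact absurd he.symm (hSmain _ _ h' _)
    · simp [F] at he
    · simpa [F, hβ.eq_iff] using he
    · exact absurd he.symm (hSconn _ _ h' _ _)
    · exact absurd he (hSmain _ _ h _)
    · exact absurd he (hSconn _ _ h _ _)
    · obtain ⟨rfl, rfl⟩ := hSinj _ _ h _ _ h' he
      rfl
  refine ⟨⟨⟨z ∘ F, hz.injective.comp hF⟩, ?_⟩⟩
  rintro (i | ⟨i, j, h⟩ | ⟨i, j, h⟩) (i' | ⟨i', j', h'⟩ | ⟨i', j', h'⟩)
  · exact iff_of_false (hmain _ _) id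
  · exact hmid _ _ h' _
  · exact hside _ _ h' _
  · rw [SimpleGraph.adj_comm, SimpleGraph.adj_comm _ (HostVertex.mid _ _ _)]
    exact hmid _ _ h _
  · exact iff_of_false (hz.not_adj (by simp [link, par, extraLink])) id
  · exact iff_of_false (hcs _ _ _ _ h') id
  · rw [SimpleGraph.adj_comm, SimpleGraph.adj_comm _ (HostVertex.side _ _ _)]
    exact hside _ _ h _
  · exact iff_of_false (fun hadj' => hcs _ _ _ _ h hadj'.symm) id
  · exact hss _ _ h _ _ h'

/-- A realization whose main vertices contain a large stable set, coming from a clique of `Q`,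
contains a host graph. If `main t.thd` is adjacent to `mi t`, then `lo t` and `mi t` are the inner
vertices of a path from `main t.fst` to `main t.thd`, otherwise `mi t` and `hi t` are those of a path
from `main t.snd` to `main t.thd`. By Ramsey's theorem the latter paths exist for all pairs of a
large set, or the former ones do; in this case the middle entries have to avoid the branch vertices.
-/
theorem exists_card_forall_exists_embedding_hostGraph (k : ℕ) : ∃ M : ℕ, ∀ {N : ℕ}
    {Q : SimpleGraph (Fin N)} {U : Type*} {G : SimpleGraph U} {z : PatternVertex N → U},
    IsRealization Q G z → ∀ K : Finset (Fin N), M ≤ K.card →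
      (∀ u ∈ K, ∀ v ∈ K, u ≠ v → Q.Adj u v ∧ ¬ G.Adj (z (main u)) (z (main v))) →
      Nonempty (hostGraph (Fin k) ↪g G) := by
  obtain ⟨M, hM⟩ := exists_monochromatic_subset (2 * k) k
  refine ⟨M, fun {N Q U G z} hz K hK hKQ => ?_⟩
  have hKmain : ∀ u ∈ K, ∀ v ∈ K, ¬ G.Adj (z (main u)) (z (main v)) := by
    intro u hu v hv
    by_cases huv : u = v
    · rw [huv]
      exact G.irrefl
    · exact (hKQ u hu v hv huv).2
  obtain ⟨S, hSK, ⟨hcard, hS⟩ | ⟨hcard, hS⟩⟩ := hM K hK fun u v =>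
    ∀ t : IncTriple N, t.fst ∈ K → t.snd = u → t.thd = v → G.Adj (z (main v)) (z (mi t))
  · set σ := S.orderEmbOfFin hcard
    have hσ : ∀ i, σ i ∈ S := S.orderEmbOfFin_mem hcard
    -- the branch vertices are those of even index
    let β : Fin k → Fin N := fun i => σ ⟨2 * i, by omega⟩
    let γ : Fin k → Fin N := fun i => σ ⟨2 * i + 1, by omega⟩
    have hβγ : ∀ i l, β i ≠ γ l := fun i l h => by
      have := congrArg Fin.val (σ.injective h)
      simp only at this
      omega
    have hβ : Function.Injective β := fun i j h => by
      have := congrArg Fin.val (σ.injective h)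
      simp only at this
      omega
    have hβK : ∀ i, β i ∈ K := fun i => hSK (hσ _)
    have h1 : ∀ i, β i < γ i := fun i => σ.strictMono (by simp)
    have h2 : ∀ i j, i < j → γ i < β j := fun i j h => σ.strictMono (by
      rw [Fin.lt_def] at h ⊢
      simp only
      omega)
    refine hz.exists_embedding_hostGraph hβ
      (fun i j h => (hKQ _ (hβK i) _ (hβK j) (hβ.ne h)).1) (fun i j => hKmain _ (hβK i) _ (hβK j))
      (fun i j h => ⟨β i, γ i, β j, h1 i, h2 i j h⟩) (fun i j h i' j' h' ht => ?_)
      (x := lo) (y := mi) (Or.inr ⟨rfl, rfl⟩) (fun i j h l => ?_) (fun i j h l => ?_)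
    · simp only [IncTriple.mk.injEq, hβ.eq_iff] at ht
      exact ⟨ht.1, ht.2.2⟩
    · by_cases hl : l = i
      · simp only [hl, iff_true]
        exact (hz.adj (main (β i)) (lo ⟨β i, γ i, β j, h1 i, h2 i j h⟩) rfl).symm
      · simp only [hl, iff_false]
        exact hz.not_adj (by simp [link, par, extraLink, hβ.eq_iff, hl, hβγ])
    · by_cases hl : l = j
      · simp only [hl, iff_true]
        exact hS (γ i) (hσ _) (β j) (hσ _) (h2 i j h) _ (hβK i) rfl rfl
      · simp only [hl, iff_false]
        exact hz.not_adj (by simp [link, par, extraLink, hβ.eq_iff, hl, hβγ])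
  · set β := S.orderEmbOfFin hcard
    have hβS : ∀ i, β i ∈ S := S.orderEmbOfFin_mem hcard
    have hβK : ∀ i, β i ∈ K := fun i => hSK (hβS i)
    have hlt : ∀ i j, i < j → β i < β j := fun i j h => β.strictMono h
    have hex : ∀ i j : Fin k, i < j → ∃ t : IncTriple N, t.snd = β i ∧ t.thd = β j ∧
        ¬ G.Adj (z (main (β j))) (z (mi t)) := by
      intro i j h
      have := hS _ (hβS i) _ (hβS j) (hlt i j h)
      push Not at this
      obtain ⟨t, -, h1, h2, h3⟩ := this
      exact ⟨t, h1, h2, h3⟩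
    choose T hT1 hT2 hT3 using hex
    refine hz.exists_embedding_hostGraph β.injective
      (fun i j h => (hKQ _ (hβK i) _ (hβK j) (β.injective.ne h)).1)
      (fun i j => hKmain _ (hβK i) _ (hβK j)) T (fun i j h i' j' h' ht => ?_)
      (x := mi) (y := hi) (Or.inl ⟨rfl, rfl⟩) (fun i j h l => ?_) (fun i j h l => ?_)
    · refine ⟨β.injective ?_, β.injective ?_⟩
      · rw [← hT1 i j h, ht, hT1]
      · rw [← hT2 i j h, ht, hT2]
    · by_cases hl : l = i
      · simp only [hl, iff_true]
        exact (hz.adj (main _) (mi _) (hT1 i j h).symm).symm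
      · simp only [hl, iff_false]
        by_cases hl' : l = j
        · rw [hl']
          exact hT3 i j h
        · exact hz.not_adj (by simp [link, par, extraLink, hT1, hT2, hl, hl'])
    · by_cases hl : l = j
      · simp only [hl, iff_true]
        exact (hz.adj (main _) (hi _) (hT2 i j h).symm).symm
      · simp only [hl, iff_false]
        exact hz.not_adj (by simp [link, par, extraLink, hT2, hl])

end PatternVertex

theorem theorem7p7 {V W : Type*} [Finite V] [Finite W] (H' : SimpleGraph V) (H : SimpleGraph W)
    (hH : IsGeOneSubdivision H H') :
    IsAlmostBipartite H ∧
      ∃ (s : ℕ) (ε : ℝ), 0 < s ∧ 0 < ε ∧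
        ∀ (U : Type*) [Finite U] (G : SimpleGraph U),
          IsBoundedGraph G ε → ¬ H ⊴ G →
            ∀ c : ℝ, 0 < c → c ≤ 1 →
              ∃ A B : Finset U,
                IsXYPair (ε * c ^ s * Nat.card U) (ε * Nat.card U) A B ∧
                  IsSparsePair G c A B := by
  classical
  obtain ⟨ℓ, ⟨φ⟩⟩ := exists_embedding_hostGraph hH
  refine ⟨isAlmostBipartite_of_embedding_hostGraph φ, ?_⟩
  obtain ⟨k, ⟨e⟩⟩ := Finite.exists_equiv_fin (V ⊕ (Σ e : H'.edgeSet, Fin (ℓ e)))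
  obtain ⟨M, hM⟩ := PatternVertex.exists_card_forall_exists_embedding_hostGraph k
  obtain ⟨N, Q, hQ⟩ := exists_inducedRamsey_clique_fin H M
  obtain ⟨P, hpar, hlink⟩ := PatternVertex.exists_pattern Q
  have := Fintype.ofFinite (PatternVertex N)
  obtain ⟨ε₀, s₀, hε₀, hP⟩ := P.exists_embedding
  refine ⟨max s₀ 1, min ε₀ (1 / 8), by simp, by positivity, ?_⟩
  intro U _ G hG hHG c hc hc1
  by_contra! hno
  have := Fintype.ofFinite U
  rcases isEmpty_or_nonempty U with hU | hU
  · refine hno ∅ ∅ ⟨by simp, by simp, by simp⟩ ⟨by simp, ?_⟩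
    simp [SimpleGraph.interedges, Rel.interedges]
  have hrich := isRich_of_forall_not_isSparsePair (by positivity) (min_le_right _ _) hc hc1 hG hno
  obtain ⟨z, hadj, hnot⟩ := hP U G _ c _ (by positivity) (min_le_left _ _) (le_max_left _ _) hc hc1
    hrich
  have hz : PatternVertex.IsRealization Q G z :=
    ⟨by rwa [hpar] at hadj, by rwa [hlink] at hnot⟩
  rcases hQ (fun u v => G.Adj (z (.main u)) (z (.main v))) (fun _ _ h => h.symm) with
    ⟨f, hf⟩ | ⟨K, hK, hKQ⟩
  · refine hHG ⟨⟨fun x => z (.main (f x)), fun x y h => ?_⟩, ?_⟩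
    · simpa using hz.injective h
    · intro x y
      refine ⟨fun h => ?_, hf x y⟩
      by_contra hxy
      refine hz.not_adj ?_ h
      have h1 : ¬ Q.Adj (f x) (f y) := fun h' => hxy (f.map_rel_iff.1 h')
      have h2 : ¬ Q.Adj (f y) (f x) := fun h' => h1 h'.symm
      simp [PatternVertex.link, PatternVertex.par, PatternVertex.extraLink, h1, h2]
  · obtain ⟨ψ⟩ := hM hz K hK.ge hKQ
    exact hHG ⟨φ.trans ((hostGraphMap e.toEmbedding).trans ψ)⟩
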